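/- Conventions. A Pontryagin space is a complex vector space with a Hermitian form $\langle\cdot,\cdot\rangle$ that is the orthogonal direct sum of a Hilbert space and the anti-space of a finite-dimensional Hilbert space; the dimension of the latter is its negative index. Topological notions refer to the strong topology, defined by any such decomposition, and adjoints are taken with respect to the indefinite inner products. Let $\mathcal U,\mathcal Y$ be separable Pontryagin spaces with the same negative index, and let $\kappa\in\{0,1,2,\dots\}$. The class $\mathbf S_\kappa(\mathcal U,\mathcal Y)$ consists of the $\mathcal L(\mathcal U,\mathcal Y)$-valued functions $\theta$ holomorphic on a connected open neighbourhood $\Omega$ of $0$ in the open unit disk such that the kernel $K_\theta(w,z)=\frac{1-\theta(z)\theta(w)^*}{1-z\bar w}$ has $\kappa$ negative squares, that is: for all $w_1,\dots,w_n\in\Omega$ and $f_1,\dots,f_n\in\mathcal Y$, the Hermitian matrix $(\langle K_\theta(w_j,w_i)f_j,f_i\rangle)_{i,j=1}^n$ has at most $\kappa$ negative eigenvalues (counted with multiplicity), and some such matrix has exactly $\kappa$. A system $\Sigma=(A,B,C,D;\mathcal X)$ consists of a separable Pontryagin space $\mathcal X$ (the state space) and bounded operators $A:\mathcal X\to\mathcal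 X$, $B:\mathcal U\to\mathcal X$, $C:\mathcal X\to\mathcal Y$, $D:\mathcal U\to\mathcal Y$. It is passive if $\begin{pmatrix}A&B\\C&D\end{pmatrix}:\mathcal X\oplus\mathcal U\to\mathcal X\oplus\mathcal Y$ is contractive with respect to the indefinite inner products; it is a realization of $\theta$ if $\theta(z)=D+zC(I-zA)^{-1}B$ for all $z$ near $0$; it is controllable if the linear span of the ranges of $A^nB$, $n\ge0$, is dense in $\mathcal X$, observable if the linear span of the ranges of $A^{*n}C^*$, $n\ge 0$, is dense in $\mathcal X$, and minimal if it is both. For $\theta\in\mathbf S_\kappa(\mathcal U,\mathcal Y)$, a passive realization of $\theta$ is $\kappa$-admissible if its state space has negative index $\kappa$. Two systems with state spaces $\mathcal X_1,\mathcal X_2$ are unitarily similar if $D_1=D_2$ and there is a unitary operator $V:\mathcal X_1\to\mathcal X_2$ (with respect to the indefinite inner products) such that $A_1=V^{-1}A_2V$, $B_1=V^{-1}B_2$, $C_1=C_2V$. Write $E(x)=\langle x,x\rangle$. A $\kappa$-admissible passive realization $\Sigma$ of $\theta$ is optimal if $$E\Big(\sum_{k=0}^nA^kBu_k\Big)\le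 E\Big(\sum_{k=0}^nA'^kB'u_k\Big)\qquad(n\ge0,\ u_0,\dots,u_n\in\mathcal U)$$ for every $\kappa$-admissible passive realization $\Sigma'=(A',B',C',D';\mathcal X')$ of $\theta$; it is $*$-optimal if it is observable and the reverse inequality $\ge$ holds for every observable $\kappa$-admissible passive realization $\Sigma'$ of $\theta$. Statement. Let $\theta\in\mathbf S_\kappa(\mathcal U,\mathcal Y)$. Then the following are equivalent: (i) any two $\kappa$-admissible minimal passive realizations of $\theta$ are unitarily similar; (ii) there exists a minimal passive realization of $\theta$ that is both optimal and $*$-optimal; (iii) every $\kappa$-admissible minimal passive realization of $\theta$ is both optimal and $*$-optimal. -/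

import Mathlib

open scoped Topology

universe w u v

/-- A Pontryagin space, given as a Hilbert space together with a fundamental symmetry `J`
(`J = J† = J⁻¹`) whose `(-1)`-eigenspace is finite dimensional.  The Hilbert space norm is the one
of the fundamental decomposition `ker (J - 1) ⊕ ker (J + 1)`, so its topology is the strong
topology.  All notions below depend only on the indefinite inner product and on the strong
topology, not on the choice of `J`.
Completeness is carried by the separate instance `CompleteSpace`. -/
class PontryaginSpace (X : Type u) [NormedAddCommGroup X] [InnerProductSpace ℂ X] where
  /-- the fundamental symmetry -/
  J : X →L[ℂ] X
  J_symm : ∀ x y : X, inner ℂ (J x) y = inner ℂ x (J y)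
  J_invol : ∀ x : X, J (J x) = x
  finite_neg : FiniteDimensional ℂ (LinearMap.ker ((J + 1 : X →L[ℂ] X) : X →ₗ[ℂ] X))

namespace PontryaginSpace

section Basic

variable {X : Type u} [NormedAddCommGroup X] [InnerProductSpace ℂ X] [PontryaginSpace X]
variable {Y : Type v} [NormedAddCommGroup Y] [InnerProductSpace ℂ Y] [PontryaginSpace Y]

/-- The indefinite inner product `⟨x, y⟩`, linear in `x` and conjugate-linear in `y`. -/
noncomputable def form (x y : X) : ℂ := inner ℂ y (J x)

/-- `E x = ⟨x, x⟩`, which is a real number. -/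
noncomputable def energy (x : X) : ℝ := (form x x).re

variable (X) in
/-- The negative index: the dimension of the anti-Hilbert part of a fundamental decomposition. -/
noncomputable def negIndex : ℕ :=
  Module.finrank ℂ (LinearMap.ker ((J + 1 : X →L[ℂ] X) : X →ₗ[ℂ] X))

theorem form_conj (x y : X) : (starRingEnd ℂ) (form x y) = form y x := by
  unfold form
  rw [inner_conj_symm, J_symm]

theorem energy_eq (x : X) : ((energy x : ℝ) : ℂ) = form x x :=
  Complex.conj_eq_iff_re.mp (form_conj x x)

/-- The adjoint of a bounded operator with respect to the indefinite inner products. -/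
noncomputable def adj [CompleteSpace X] [CompleteSpace Y] (T : X →L[ℂ] Y) : Y →L[ℂ] X :=
  J ∘L (ContinuousLinearMap.adjoint T) ∘L J

theorem form_adj [CompleteSpace X] [CompleteSpace Y] (T : X →L[ℂ] Y) (x : X) (y : Y) :
    form (T x) y = form x (adj T y) := by
  simp only [form, adj, ContinuousLinearMap.comp_apply]
  rw [J_symm, J_invol, ContinuousLinearMap.adjoint_inner_left, J_symm]

end Basic

section Schur

variable {U : Type u} [NormedAddCommGroup U] [InnerProductSpace ℂ U] [CompleteSpace U]
  [PontryaginSpace U]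
variable {Y : Type v} [NormedAddCommGroup Y] [InnerProductSpace ℂ Y] [CompleteSpace Y]
  [PontryaginSpace Y]

/-- The Schur kernel `K_θ(w, z) = (1 - θ(z) θ(w)^*) / (1 - z w̄)`. -/
noncomputable def schurKernel (θ : ℂ → (U →L[ℂ] Y)) (w z : ℂ) : Y →L[ℂ] Y :=
  (1 - z * (starRingEnd ℂ) w)⁻¹ • (1 - (θ z) ∘L adj (θ w))

/-- The matrix `(⟨K_θ(w_j, w_i) f_j, f_i⟩)_{i,j}`. -/
noncomputable def kernelMatrix (θ : ℂ → (U →L[ℂ] Y)) {n : ℕ} (w : Fin n → ℂ) (f : Fin n → Y) :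
    Matrix (Fin n) (Fin n) ℂ :=
  Matrix.of fun i j => form (schurKernel θ (w j) (w i) (f j)) (f i)

theorem form_schurKernel (θ : ℂ → (U →L[ℂ] Y)) (w z : ℂ) (f g : Y) :
    form (schurKernel θ w z f) g =
      (1 - z * (starRingEnd ℂ) w)⁻¹ * (form f g - form (adj (θ w) f) (adj (θ z) g)) := by
  rw [← form_adj]
  simp [form, schurKernel]

theorem kernelMatrix_isHermitian (θ : ℂ → (U →L[ℂ] Y)) {n : ℕ} (w : Fin n → ℂ)
    (f : Fin n → Y) : (kernelMatrix θ w f).IsHermitian := by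
  ext i j
  simp only [kernelMatrix, Matrix.conjTranspose_apply, Matrix.of_apply, form_schurKernel]
  rw [← starRingEnd_apply, map_mul, map_inv₀, map_sub, map_sub, map_mul, form_conj, form_conj]
  simp [mul_comm]

/-- The number of negative eigenvalues, with multiplicity, of `kernelMatrix θ w f`. -/
noncomputable def negEigenvalueCount (θ : ℂ → (U →L[ℂ] Y)) {n : ℕ} (w : Fin n → ℂ)
    (f : Fin n → Y) : ℕ :=
  Nat.card {i : Fin n // (kernelMatrix_isHermitian θ w f).eigenvalues i < 0}

/-- The Schur kernel of `θ` has `κ` negative squares on `Ω`. -/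
def HasNegativeSquares (κ : ℕ) (θ : ℂ → (U →L[ℂ] Y)) (Ω : Set ℂ) : Prop :=
  (∀ (n : ℕ) (w : Fin n → ℂ) (f : Fin n → Y), (∀ i, w i ∈ Ω) → negEigenvalueCount θ w f ≤ κ) ∧
  (∃ (n : ℕ) (w : Fin n → ℂ) (f : Fin n → Y), (∀ i, w i ∈ Ω) ∧ negEigenvalueCount θ w f = κ)

/-- The generalized Schur class `S_κ(U, Y)`: `θ` is holomorphic on a subregion of the open unit
disk that contains the origin, and its Schur kernel has `κ` negative squares there. Only the germ
of `θ` at the origin matters; values outside the region are irrelevant. -/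
def IsGeneralizedSchur (κ : ℕ) (θ : ℂ → (U →L[ℂ] Y)) : Prop :=
  ∃ Ω : Set ℂ, IsOpen Ω ∧ IsPreconnected Ω ∧ (0 : ℂ) ∈ Ω ∧ Ω ⊆ Metric.ball (0 : ℂ) 1 ∧
    DifferentiableOn ℂ θ Ω ∧ HasNegativeSquares κ θ Ω

end Schur

/-- An operator colligation (linear system) with incoming space `U`, outgoing space `Y` and a
separable Pontryagin state space `X`, given by the blocks of its system operator. -/
structure LinSystem (U : Type u) (Y : Type v) [NormedAddCommGroup U] [InnerProductSpace ℂ U]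
    [NormedAddCommGroup Y] [InnerProductSpace ℂ Y] : Type (max u v (w + 1)) where
  X : Type w
  [normedAddCommGroup : NormedAddCommGroup X]
  [innerProductSpace : InnerProductSpace ℂ X]
  [completeSpace : CompleteSpace X]
  [separableSpace : TopologicalSpace.SeparableSpace X]
  [pontryaginSpace : PontryaginSpace X]
  A : X →L[ℂ] X
  B : U →L[ℂ] X
  C : X →L[ℂ] Y
  D : U →L[ℂ] Y

attribute [instance] LinSystem.normedAddCommGroup LinSystem.innerProductSpace
  LinSystem.completeSpace LinSystem.separableSpace LinSystem.pontryaginSpace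

namespace LinSystem

variable {U : Type u} [NormedAddCommGroup U] [InnerProductSpace ℂ U]
variable {Y : Type v} [NormedAddCommGroup Y] [InnerProductSpace ℂ Y]

/-- The system operator `(x, u) ↦ (A x + B u, C x + D u)`. -/
noncomputable def systemOperator (S : LinSystem.{w} U Y) : (S.X × U) →L[ℂ] (S.X × Y) :=
  (S.A.coprod S.B).prod (S.C.coprod S.D)

/-- The transfer function `θ_S(z) = D + z C (I - z A)⁻¹ B` (used where `I - z A` is invertible,
in particular near the origin). -/
noncomputable def transfer (S : LinSystem.{w} U Y) (z : ℂ) : U →L[ℂ] Y :=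
  S.D + z • (S.C ∘L Ring.inverse (1 - z • S.A) ∘L S.B)

/-- `S` is a realization of `θ`: the transfer function agrees with `θ` near the origin. -/
def IsRealization (S : LinSystem.{w} U Y) (θ : ℂ → (U →L[ℂ] Y)) : Prop :=
  ∀ᶠ z in 𝓝 (0 : ℂ), S.transfer z = θ z

/-- `∑_{k=0}^n A^k B u_k`. -/
noncomputable def reach (S : LinSystem.{w} U Y) (n : ℕ) (a : ℕ → U) : S.X :=
  ∑ k ∈ Finset.range (n + 1), (S.A ^ k) (S.B (a k))

/-- The controllable subspace is the whole state space. -/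
def IsControllable (S : LinSystem.{w} U Y) : Prop :=
  (⨆ n : ℕ, LinearMap.range (((S.A ^ n) ∘L S.B : U →L[ℂ] S.X) : U →ₗ[ℂ] S.X)).topologicalClosure
    = ⊤

/-- The two systems are unitarily similar. -/
def UnitarilySimilar (S T : LinSystem.{w} U Y) : Prop :=
  S.D = T.D ∧ ∃ V : S.X ≃L[ℂ] T.X,
    (∀ x y : S.X, form (V x) (V y) = form x y) ∧
    (∀ x : S.X, S.A x = V.symm (T.A (V x))) ∧
    (∀ a : U, S.B a = V.symm (T.B a)) ∧
    (∀ x : S.X, S.C x = T.C (V x))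

variable [PontryaginSpace U] [PontryaginSpace Y]

/-- The system operator is a contraction from `X ⊕ U` to `X ⊕ Y` with respect to the indefinite
inner products of the orthogonal direct sums. -/
def IsPassive (S : LinSystem.{w} U Y) : Prop :=
  ∀ p : S.X × U, energy (S.systemOperator p).1 + energy (S.systemOperator p).2 ≤
    energy p.1 + energy p.2

/-- The observable subspace, the closed span of the ranges of `A^{*n} C^*` with indefinite
adjoints, is the whole state space. -/
def IsObservable [CompleteSpace Y] (S : LinSystem.{w} U Y) : Prop :=
  (⨆ n : ℕ, LinearMap.range
    ((((adj S.A) ^ n) ∘L adj S.C : Y →L[ℂ] S.X) : Y →ₗ[ℂ] S.X)).topologicalClosure = ⊤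

/-- Minimal means controllable and observable. -/
def IsMinimal [CompleteSpace Y] (S : LinSystem.{w} U Y) : Prop :=
  S.IsControllable ∧ S.IsObservable

/-- A `κ`-admissible passive realization of `θ` (where `θ` is in the class `S_κ`): a passive
realization whose state space has negative index `κ`. -/
def IsAdmissible (κ : ℕ) (θ : ℂ → (U →L[ℂ] Y)) (S : LinSystem.{w} U Y) : Prop :=
  S.IsPassive ∧ S.IsRealization θ ∧ negIndex S.X = κ

/-- Optimality, within the class of passive realizations of `θ` with state space of negative
index `κ`. -/
def IsOptimal (κ : ℕ) (θ : ℂ → (U →L[ℂ] Y)) (S : LinSystem.{w} U Y) : Prop :=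
  S.IsAdmissible κ θ ∧
    ∀ T : LinSystem.{w} U Y, T.IsAdmissible κ θ →
      ∀ (n : ℕ) (a : ℕ → U), energy (S.reach n a) ≤ energy (T.reach n a)

/-- `*`-optimality, within the class of observable passive realizations of `θ` with state space of
negative index `κ`. -/
def IsStarOptimal [CompleteSpace Y] (κ : ℕ) (θ : ℂ → (U →L[ℂ] Y)) (S : LinSystem.{w} U Y) :
    Prop :=
  S.IsAdmissible κ θ ∧ S.IsObservable ∧
    ∀ T : LinSystem.{w} U Y, T.IsAdmissible κ θ → T.IsObservable →
      ∀ (n : ℕ) (a : ℕ → U), energy (T.reach n a) ≤ energy (S.reach n a)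

end LinSystem

end PontryaginSpace

/-!
The equivalence reduces to comparing, over all `κ`-admissible passive realizations, the energies of
the states reached by the same inputs. Three facts suffice.

* Two controllable systems of the same negative index whose reachable states have equal energies and
  whose transfer functions have the same germ are unitarily similar
  (`unitarilySimilar_of_energy_eq`): the map between the reachable states is an isometry on a dense
  subspace, and a densely defined contraction between Pontryagin spaces of equal negative index is
  automatically bounded (`exists_extension`). So if some realization is both optimal and `*`-optimal,
  all minimal ones have the energies of that one, and are similar to each other.
* A `κ`-admissible realization has a `κ`-admissible controllable part, which keeps the energies and
  the observability (`IsAdmissible.exists_controllable`), and a `κ`-admissible observable part, whose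
  energies are no larger (`IsAdmissible.exists_observable`). So if all minimal realizations are
  similar to each other, each of them is optimal and `*`-optimal.
* A `κ`-admissible realization exists (`IsGeneralizedSchur.exists_isAdmissible`).

The controllable part is obtained without discussing whether the controllable subspace is regular:
the input sequences, with the possibly degenerate form of the states they reach, are completed to a
Pontryagin space (`exists_completion`), and the system operator, a densely defined contraction there,
is extended by `exists_extension`. The observable part is the adjoint of the controllable part of the
adjoint system, adjoints of contractions being contractions (`energy_adj_le`). A priori the negative
index drops, but every passive realization has index at least `κ` (`le_negIndex_of_isRealization`).

The last statement and the existence of a realization both rest on the Pontryagin space `P` of the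
Schur kernel on `Ω`, the completion of the finitely supported functions `Ω →₀ Y`. Its kernel vectors
are locally bounded and depend antiholomorphically on the point, so that by the identity theorem
those at points near the origin are already total (`IsKernelSpace.eq_zero_of_eventually`). For a
passive realization they map contractively to the state space, which bounds its negative index from
below; and the isometry `(w̄ k_w f, f) ↦ (k_w f, θ(w)* f)` extends to the adjoint of the system
operator of a passive realization with state space `P`.
-/

namespace PontryaginSpace

/-! ### Negative subspaces of Hermitian forms -/

section Sesquilinear

open scoped ComplexConjugate

variable {L : Type*} [AddCommGroup L] [Module ℂ L]

/-- `q` is negative on the nonzero vectors of some `k`-dimensional subspace, given as the range of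
a linear map `φ` from `ℂ ^ k`; negativity makes `φ` injective. -/
def HasNeg (q : L → ℝ) (k : ℕ) : Prop :=
  ∃ φ : (Fin k → ℂ) →ₗ[ℂ] L, ∀ c, c ≠ 0 → q (φ c) < 0

theorem hasNeg_of_linearMap {q : L → ℝ} {E : Type*} [AddCommGroup E] [Module ℂ E]
    [FiniteDimensional ℂ E] (ψ : E →ₗ[ℂ] L) (hψ : ∀ c, c ≠ 0 → q (ψ c) < 0) :
    HasNeg q (Module.finrank ℂ E) := by
  let e := (Module.finBasis ℂ E).equivFun.symm
  exact ⟨ψ ∘ₗ e.toLinearMap, fun c hc => hψ _ (by simpa using hc)⟩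

theorem HasNeg.mono {q : L → ℝ} {k l : ℕ} (h : HasNeg q k) (hl : l ≤ k) : HasNeg q l := by
  obtain ⟨φ, hφ⟩ := h
  let j : (Fin l → ℂ) →ₗ[ℂ] (Fin k → ℂ) := Function.ExtendByZero.linearMap ℂ (Fin.castLE hl)
  have hj : Function.Injective j :=
    Function.extend_injective (Fin.castLE_injective hl) _
  exact ⟨φ ∘ₗ j, fun c hc => hφ _ fun h0 => hc (hj (by rw [h0, map_zero]))⟩

/-- Negative subspaces are pushed forward by contractions. -/
theorem HasNeg.map {q : L → ℝ} {k : ℕ} (h : HasNeg q k) {M : Type*} [AddCommGroup M] [Module ℂ M]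
    {r : M → ℝ} (T : L →ₗ[ℂ] M) (hT : ∀ x, r (T x) ≤ q x) : HasNeg r k := by
  obtain ⟨φ, hφ⟩ := h
  exact ⟨T ∘ₗ φ, fun c hc => (hT _).trans_lt (hφ c hc)⟩

variable {h : L →ₗ[ℂ] L →ₗ⋆[ℂ] ℂ}

/-- The quadratic form `x ↦ h x x` of a sesquilinear form. -/
noncomputable def quad (h : L →ₗ[ℂ] L →ₗ⋆[ℂ] ℂ) (x : L) : ℝ := (h x x).re

theorem quad_add (hs : ∀ x y, conj (h x y) = h y x) (x y : L) :
    quad h (x + y) = quad h x + 2 * (h x y).re + quad h y := by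
  have : (h y x).re = (h x y).re := by rw [← hs x y, Complex.conj_re]
  simp only [quad, map_add, LinearMap.add_apply, Complex.add_re]
  rw [this]; ring

theorem quad_smul (a : ℂ) (x : L) : quad h (a • x) = ‖a‖ ^ 2 * quad h x := by
  simp only [quad, map_smul, LinearMap.smul_apply, LinearMap.map_smulₛₗ, smul_eq_mul]
  rw [← mul_assoc, mul_comm _ a, Complex.mul_conj, Complex.normSq_eq_norm_sq, Complex.re_ofReal_mul]

theorem quad_add_of_orthogonal (hs : ∀ x y, conj (h x y) = h y x) {x y : L} (hxy : h x y = 0) :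
    quad h (x + y) = quad h x + quad h y := by
  rw [quad_add hs, hxy]; simp

/-- The coordinates `h x (φ eᵢ)` of `x` against the vectors spanning the range of `φ`. -/
noncomputable def gram (h : L →ₗ[ℂ] L →ₗ⋆[ℂ] ℂ) {k : ℕ} (φ : (Fin k → ℂ) →ₗ[ℂ] L) :
    L →ₗ[ℂ] (Fin k → ℂ) where
  toFun x i := h x (φ (Pi.single i 1))
  map_add' x y := by ext i; simp
  map_smul' a x := by ext i; simp

theorem eq_zero_of_gram {k : ℕ} {φ : (Fin k → ℂ) →ₗ[ℂ] L} {x : L} (hx : gram h φ x = 0)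
    (d : Fin k → ℂ) : h x (φ d) = 0 := by
  have hd : d = ∑ i, d i • (Pi.single i 1 : Fin k → ℂ) := by
    ext j; simp [Finset.sum_apply, Pi.single_apply]
  rw [hd, map_sum, map_sum]
  refine Finset.sum_eq_zero fun i _ => ?_
  have : h x (φ (Pi.single i 1)) = 0 := congrFun hx i
  rw [map_smul, LinearMap.map_smulₛₗ, this, smul_zero]

/-- A negative subspace is complemented by its orthogonal companion: `G` inverts the Gram matrix,
so that `φ ∘ G ∘ gram h φ` is the orthogonal projection onto the range of `φ`. -/
theorem exists_gram_inverse {k : ℕ} {φ : (Fin k → ℂ) →ₗ[ℂ] L}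
    (hφ : ∀ c, c ≠ 0 → quad h (φ c) < 0) :
    ∃ G : (Fin k → ℂ) →ₗ[ℂ] (Fin k → ℂ), (∀ x d, h (x - φ (G (gram h φ x))) (φ d) = 0) ∧
      ∀ c, G (gram h φ (φ c)) = c := by
  have hinj : Function.Injective (gram h φ ∘ₗ φ) := by
    rw [injective_iff_map_eq_zero]
    intro c hc
    by_contra h0
    have := hφ c h0
    rw [quad, eq_zero_of_gram hc] at this
    simp at this
  let e := LinearEquiv.ofInjectiveEndo _ hinj
  have he : ∀ c, gram h φ (φ c) = e c := fun c => rfl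
  refine ⟨e.symm.toLinearMap, fun x d => eq_zero_of_gram ?_ d, fun c => ?_⟩
  · rw [map_sub, he]; simp
  · rw [he]; simp

/-- A vector of negative square orthogonal to a negative subspace enlarges it. -/
theorem HasNeg.succ (hs : ∀ x y, conj (h x y) = h y x) {k : ℕ} {φ : (Fin k → ℂ) →ₗ[ℂ] L}
    (hφ : ∀ c, c ≠ 0 → quad h (φ c) < 0) {x : L} (hx : ∀ d, h x (φ d) = 0)
    (hneg : quad h x < 0) : HasNeg (quad h) (k + 1) := by
  have := hasNeg_of_linearMap (q := quad h) (E := (Fin k → ℂ) × ℂ)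
    (φ.coprod (LinearMap.toSpanSingleton ℂ L x)) fun c hc => ?_
  · simpa using this
  · obtain ⟨c, t⟩ := c
    simp only [LinearMap.coprod_apply, LinearMap.toSpanSingleton_apply]
    have h1 : h (φ c) (t • x) = 0 := by
      rw [← hs, map_smul, LinearMap.smul_apply, hx]; simp
    rw [quad_add_of_orthogonal hs h1, quad_smul]
    by_cases ht : t = 0
    · have hc' : c ≠ 0 := fun h0 => hc (by simp [ht, h0])
      simpa [ht] using hφ c hc'
    · have h2 : quad h (φ c) ≤ 0 := by
        by_cases hc' : c = 0
        · simp [hc', quad]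
        · exact (hφ c hc').le
      have : 0 < ‖t‖ ^ 2 := by positivity
      nlinarith

end Sesquilinear

/-! ### Geometry of Pontryagin spaces -/

section Space

variable {X : Type u} [NormedAddCommGroup X] [InnerProductSpace ℂ X] [PontryaginSpace X]

theorem norm_J (x : X) : ‖(J x : X)‖ = ‖x‖ := by
  have : ‖(J x : X)‖ ^ 2 = ‖x‖ ^ 2 := by
    have h := J_symm (X := X) x (J x)
    rw [J_invol] at h
    rw [← inner_self_eq_norm_sq (𝕜 := ℂ), ← inner_self_eq_norm_sq (𝕜 := ℂ), h]
  exact (sq_eq_sq₀ (norm_nonneg _) (norm_nonneg _)).mp this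

variable (X) in
/-- The indefinite inner product as a sesquilinear map. -/
noncomputable def formₗ : X →ₗ[ℂ] X →ₗ⋆[ℂ] ℂ :=
  LinearMap.mk₂'ₛₗ (RingHom.id ℂ) (starRingEnd ℂ) form
    (fun x y z => by simp [form]) (fun a x y => by simp [form])
    (fun x y z => by simp [form]) (fun a x y => by simp [form, mul_comm])

@[simp] theorem formₗ_apply (x y : X) : formₗ X x y = form x y := rfl

theorem quad_formₗ (x : X) : quad (formₗ X) x = energy x := rfl

theorem formₗ_symm (x y : X) : (starRingEnd ℂ) (formₗ X x y) = formₗ X y x := form_conj x y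

theorem form_add_left (x y z : X) : form (x + y) z = form x z + form y z :=
  (formₗ X).map_add₂ x y z
theorem form_sub_left (x y z : X) : form (x - y) z = form x z - form y z :=
  (formₗ X).map_sub₂ x y z
theorem form_smul_left (a : ℂ) (x z : X) : form (a • x) z = a * form x z :=
  (formₗ X).map_smul₂ a x z
theorem form_add_right (x y z : X) : form x (y + z) = form x y + form x z :=
  (formₗ X x).map_add y z
theorem form_sub_right (x y z : X) : form x (y - z) = form x y - form x z :=
  (formₗ X x).map_sub y z
theorem form_smul_right (a : ℂ) (x z : X) : form x (a • z) = (starRingEnd ℂ) a * form x z :=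
  (formₗ X x).map_smulₛₗ a z
@[simp] theorem form_zero_left (z : X) : form 0 z = 0 := (formₗ X).map_zero₂ z
@[simp] theorem form_zero_right (z : X) : form z 0 = 0 := (formₗ X z).map_zero
@[simp] theorem energy_zero : energy (0 : X) = 0 := by simp [energy]

theorem energy_add (x y : X) : energy (x + y) = energy x + 2 * (form x y).re + energy y :=
  quad_add formₗ_symm x y

theorem energy_sub (x y : X) : energy (x - y) = energy x - 2 * (form x y).re + energy y := by
  have hn : energy (-y) = energy y := by
    have := quad_smul (h := formₗ X) (-1) y
    simpa [quad_formₗ] using this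
  have hf : form x (-y) = -form x y := (formₗ X x).map_neg y
  rw [sub_eq_add_neg, energy_add, hn, hf, Complex.neg_re]; ring

theorem energy_smul (a : ℂ) (x : X) : energy (a • x) = ‖a‖ ^ 2 * energy x :=
  quad_smul (h := formₗ X) a x

theorem continuous_form : Continuous fun p : X × X => form p.1 p.2 :=
  continuous_snd.inner ((J (X := X)).continuous.comp continuous_fst)

theorem continuous_energy : Continuous (energy : X → ℝ) :=
  Complex.continuous_re.comp (continuous_form.comp (continuous_id.prodMk continuous_id))

theorem norm_form_le (x y : X) : ‖form x y‖ ≤ ‖x‖ * ‖y‖ := by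
  unfold form
  refine (norm_inner_le_norm _ _).trans ?_
  rw [norm_J, mul_comm]

theorem abs_energy_le (x : X) : |energy x| ≤ ‖x‖ ^ 2 :=
  (Complex.abs_re_le_norm _).trans ((norm_form_le x x).trans_eq (by ring))

theorem eq_zero_of_form {x : X} (hx : ∀ y, form x y = 0) : x = 0 := by
  have h : form x (J x) = 0 := hx _
  rw [form, inner_self_eq_zero] at h
  rw [← J_invol (X := X) x, h, map_zero]

theorem form_comm_zero {x y : X} (h : form x y = 0) : form y x = 0 := by
  rw [← form_conj, h, map_zero]

/-- The energy in terms of the parts `x ± J x` of the fundamental decomposition, which are twice its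
projections. -/
theorem four_mul_energy (x : X) : 4 * energy x = ‖x + J x‖ ^ 2 - ‖x - J x‖ ^ 2 := by
  rw [norm_add_sq (𝕜 := ℂ), norm_sub_sq (𝕜 := ℂ), energy, form]
  simp only [RCLike.re_to_complex]
  ring

theorem four_mul_norm_sq (x : X) : 4 * ‖x‖ ^ 2 = ‖x + J x‖ ^ 2 + ‖x - J x‖ ^ 2 := by
  rw [norm_add_sq (𝕜 := ℂ), norm_sub_sq (𝕜 := ℂ), norm_J]; ring

variable (X) in
/-- Twice the projection onto the negative part of the fundamental decomposition. -/
noncomputable def negPart :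
    X →ₗ[ℂ] LinearMap.ker ((J + 1 : X →L[ℂ] X) : X →ₗ[ℂ] X) :=
  LinearMap.codRestrict _ ((1 - J : X →L[ℂ] X) : X →ₗ[ℂ] X) fun x => by
    simp [LinearMap.mem_ker, J_invol]

instance : FiniteDimensional ℂ (LinearMap.ker ((J + 1 : X →L[ℂ] X) : X →ₗ[ℂ] X)) := finite_neg

theorem negPart_injective {k : ℕ} {φ : (Fin k → ℂ) →ₗ[ℂ] X}
    (hφ : ∀ c, c ≠ 0 → energy (φ c) < 0) : Function.Injective (negPart X ∘ₗ φ) := by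
  rw [injective_iff_map_eq_zero]
  intro c hc
  by_contra h0
  have h1 := hφ c h0
  have h2 : φ c - J (φ c) = 0 := congrArg Subtype.val hc
  have h3 := four_mul_energy (φ c)
  rw [h2] at h3
  have : 0 ≤ ‖φ c + J (φ c)‖ ^ 2 := by positivity
  simp at h3
  linarith

/-- The negative index is the largest dimension of a negative subspace. -/
theorem hasNeg_iff {k : ℕ} : HasNeg (energy : X → ℝ) k ↔ k ≤ negIndex X := by
  constructor
  · rintro ⟨φ, hφ⟩
    have := LinearMap.finrank_le_finrank_of_injective (negPart_injective hφ)
    rwa [Module.finrank_fin_fun] at this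
  · intro hk
    refine HasNeg.mono ?_ hk
    refine hasNeg_of_linearMap
      (Submodule.subtype (LinearMap.ker ((J + 1 : X →L[ℂ] X) : X →ₗ[ℂ] X))) fun c hc => ?_
    have h1 : J (c : X) = -c := by
      have := c.2
      rw [LinearMap.mem_ker] at this
      exact eq_neg_of_add_eq_zero_left this
    have h2 : (c : X) ≠ 0 := by simpa using hc
    have : energy (c : X) = - ‖(c : X)‖ ^ 2 := by
      rw [energy, form, h1, inner_neg_right, Complex.neg_re, ← inner_self_eq_norm_sq (𝕜 := ℂ)]
      rfl
    simp only [Submodule.coe_subtype, this]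
    have : 0 < ‖(c : X)‖ := norm_pos_iff.mpr h2
    nlinarith

/-- Finite-dimensional negative subspaces are uniformly negative, by compactness of the unit sphere. -/
theorem energy_uniformly_neg {k : ℕ} {φ : (Fin k → ℂ) →ₗ[ℂ] X}
    (hφ : ∀ c, c ≠ 0 → energy (φ c) < 0) : ∃ ε > 0, ∀ c, energy (φ c) ≤ -ε * ‖c‖ ^ 2 := by
  have hcont : Continuous fun c => energy (φ c) :=
    continuous_energy.comp φ.continuous_of_finiteDimensional
  rcases (Metric.sphere (0 : Fin k → ℂ) 1).eq_empty_or_nonempty with he | hne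
  · refine ⟨1, one_pos, fun c => ?_⟩
    by_cases hc : c = 0
    · simp [hc]
    · exfalso
      have : ((‖c‖⁻¹ : ℝ) : ℂ) • c ∈ Metric.sphere (0 : Fin k → ℂ) 1 := by
        simp [norm_smul, norm_ne_zero_iff.mpr hc]
      rw [he] at this
      exact this
  · obtain ⟨c₀, hc₀, hmax⟩ := (isCompact_sphere (0 : Fin k → ℂ) 1).exists_isMaxOn hne
      hcont.continuousOn
    have hc0 : c₀ ≠ 0 := by rintro rfl; simp at hc₀
    refine ⟨-energy (φ c₀), by linarith [hφ c₀ hc0], fun c => ?_⟩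
    by_cases hc : c = 0
    · simp [hc]
    · have hn : ‖c‖ ≠ 0 := norm_ne_zero_iff.mpr hc
      have hm : ((‖c‖⁻¹ : ℝ) : ℂ) • c ∈ Metric.sphere (0 : Fin k → ℂ) 1 := by
        simp [norm_smul, hn]
      have h1 := hmax hm
      simp only [Set.mem_ofPred_eq, map_smul, energy_smul] at h1
      have h2 : ‖((‖c‖⁻¹ : ℝ) : ℂ)‖ ^ 2 = (‖c‖ ^ 2)⁻¹ := by simp
      rw [h2, inv_mul_le_iff₀ (by positivity)] at h1
      linarith

omit [PontryaginSpace X] in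
theorem exists_norm_le {k : ℕ} (φ : (Fin k → ℂ) →ₗ[ℂ] X) : ∃ C > 0, ∀ c, ‖φ c‖ ≤ C * ‖c‖ := by
  let f : (Fin k → ℂ) →L[ℂ] X := ⟨φ, φ.continuous_of_finiteDimensional⟩
  refine ⟨‖f‖ + 1, by positivity, fun c => (f.le_opNorm c).trans ?_⟩
  nlinarith [norm_nonneg c]

/-- The orthogonal companion of a maximal negative subspace is uniformly positive. If
`E ≤ -ε‖·‖²` on the range of `φ`, then `E ≥ ε‖·‖²` on its companion with the same `ε`, provided
`ε ≤ 1`: for `p` in the companion some `φ c` has the same negative part as `p`, and orthogonality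
bounds the square of that part by the product of the norms of the positive parts. -/
theorem energy_uniformly_pos {k : ℕ} (hk : negIndex X = k) {φ : (Fin k → ℂ) →ₗ[ℂ] X}
    (hφ : ∀ c, c ≠ 0 → energy (φ c) < 0) :
    ∃ ε > 0, ∀ p, (∀ c, form p (φ c) = 0) → ε * ‖p‖ ^ 2 ≤ energy p := by
  obtain ⟨ε, hε, h1⟩ := energy_uniformly_neg hφ
  obtain ⟨C, hC, h2⟩ := exists_norm_le φ
  have hsurj : Function.Surjective (negPart X ∘ₗ φ) := by
    rw [← LinearMap.injective_iff_surjective_of_finrank_eq_finrank]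
    · exact negPart_injective hφ
    · rw [Module.finrank_fin_fun]; exact hk.symm
  refine ⟨min (ε / C ^ 2) 1, by positivity, fun p hp => ?_⟩
  set δ := min (ε / C ^ 2) 1 with hδ
  have hδpos : 0 < δ := by positivity
  obtain ⟨c, hc⟩ := hsurj (negPart X p)
  have hc' : φ c - J (φ c) = p - J p := congrArg Subtype.val hc
  set m := φ c with hm
  have h3 : energy m ≤ -δ * ‖m‖ ^ 2 := by
    refine (h1 c).trans ?_
    have : ‖m‖ ^ 2 ≤ C ^ 2 * ‖c‖ ^ 2 := by
      rw [← mul_pow]; exact pow_le_pow_left₀ (norm_nonneg _) (h2 c) 2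
    have h4 : δ * ‖m‖ ^ 2 ≤ δ * (C ^ 2 * ‖c‖ ^ 2) := by gcongr
    have h5 : δ * (C ^ 2 * ‖c‖ ^ 2) ≤ ε * ‖c‖ ^ 2 := by
      have : δ * C ^ 2 ≤ ε := (le_div_iff₀ (by positivity)).mp (min_le_left _ _)
      nlinarith [sq_nonneg ‖c‖]
    linarith
  have e1 := four_mul_energy m
  have e2 := four_mul_norm_sq m
  have e3 := four_mul_energy p
  have e4 := four_mul_norm_sq p
  rw [hc'] at e1 e2
  -- orthogonality of `p` and `m` in terms of the parts of the fundamental decomposition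
  have e5 : ‖p - J p‖ ^ 2 ≤ ‖p + J p‖ * ‖m + J m‖ := by
    have h6 : inner ℂ (m + J m) (p + J p) - inner ℂ (m - J m) (p - J p) = 4 * form p m := by
      have a1 : inner ℂ (J m) (J p) = (inner ℂ m p : ℂ) := by rw [J_symm, J_invol]
      have a2 : inner ℂ (J m) p = (inner ℂ m (J p) : ℂ) := J_symm m p
      simp only [form, inner_add_left, inner_add_right, inner_sub_left, inner_sub_right, a1, a2]
      ring
    rw [hp c, hc', mul_zero, sub_eq_zero] at h6
    have h7 : ‖(inner ℂ (p - J p) (p - J p) : ℂ)‖ = ‖p - J p‖ ^ 2 := by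
      rw [inner_self_eq_norm_sq_to_K]; simp
    rw [← h7, ← h6, mul_comm]
    exact norm_inner_le_norm _ _
  set a := ‖p - J p‖
  set b := ‖p + J p‖
  set d := ‖m + J m‖
  have ha : 0 ≤ a := norm_nonneg _
  have hb : 0 ≤ b := norm_nonneg _
  have hd : 0 ≤ d := norm_nonneg _
  have h8 : (1 + δ) * d ^ 2 ≤ (1 - δ) * a ^ 2 := by nlinarith
  suffices (1 + δ) * a ^ 2 ≤ (1 - δ) * b ^ 2 by nlinarith
  by_cases ha0 : a = 0
  · have : δ ≤ 1 := min_le_right _ _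
    rw [ha0]
    nlinarith [sq_nonneg b]
  · have hapos : 0 < a ^ 2 := by positivity
    have h9 : a ^ 2 * a ^ 2 ≤ b ^ 2 * d ^ 2 := by
      have := mul_self_le_mul_self (sq_nonneg a) e5
      nlinarith
    have h10 : (1 + δ) * (a ^ 2 * a ^ 2) ≤ b ^ 2 * ((1 - δ) * a ^ 2) := by nlinarith [sq_nonneg b]
    have : a ^ 2 * ((1 + δ) * a ^ 2) ≤ a ^ 2 * ((1 - δ) * b ^ 2) := by nlinarith
    exact le_of_mul_le_mul_left this hapos

end Space

/-! ### Contractions between Pontryagin spaces -/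

section Extension

variable {X : Type u} [NormedAddCommGroup X] [InnerProductSpace ℂ X] [PontryaginSpace X]
variable {Y : Type v} [NormedAddCommGroup Y] [InnerProductSpace ℂ Y] [PontryaginSpace Y]
variable {L : Type*} [AddCommGroup L] [Module ℂ L]

/-- Negative subspaces can be moved into a given dense subspace by a small perturbation. -/
theorem HasNeg.of_denseRange {ι : L →ₗ[ℂ] X} (hι : DenseRange ι) {k : ℕ}
    (h : HasNeg (energy : X → ℝ) k) : HasNeg (fun x => energy (ι x)) k := by
  obtain ⟨ψ, hψ⟩ := h
  obtain ⟨ε, hε, h1⟩ := energy_uniformly_neg hψ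
  obtain ⟨C, hC, h2⟩ := exists_norm_le ψ
  -- any `t` with `2 * C * t + t ^ 2 < ε` is admissible as a relative error
  obtain ⟨t, ht, ht1, ht2⟩ : ∃ t : ℝ, 0 < t ∧ t ≤ 1 ∧ (2 * C + 1) * t ≤ ε / 2 := by
    refine ⟨min 1 (ε / 2 / (2 * C + 1)), by positivity, min_le_left _ _, ?_⟩
    rw [← le_div_iff₀' (by positivity)]
    exact min_le_right _ _
  have hx : ∀ i : Fin k, ∃ x : L, ‖ι x - ψ (Pi.single i 1)‖ < t / (k + 1) := by
    intro i
    obtain ⟨x, hx⟩ := hι.exists_dist_lt (ψ (Pi.single i 1)) (ε := t / (k + 1)) (by positivity)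
    exact ⟨x, by rwa [← dist_eq_norm, dist_comm]⟩
  choose x hx using hx
  refine ⟨Fintype.linearCombination ℂ x, fun c hc => ?_⟩
  set r := ι (Fintype.linearCombination ℂ x c) - ψ c with hr
  have hr' : r = ∑ i, c i • (ι (x i) - ψ (Pi.single i 1)) := by
    have hd : c = ∑ i, c i • (Pi.single i 1 : Fin k → ℂ) := by
      ext j; simp [Finset.sum_apply, Pi.single_apply]
    rw [hr, Fintype.linearCombination_apply, map_sum]
    conv_lhs => rw [hd, map_sum]
    simp [smul_sub, Finset.sum_sub_distrib, Pi.single_apply]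
  have h3 : ‖r‖ ≤ t * ‖c‖ := by
    rw [hr']
    refine (norm_sum_le _ _).trans ?_
    calc ∑ i, ‖c i • (ι (x i) - ψ (Pi.single i 1))‖ ≤ ∑ _i : Fin k, ‖c‖ * (t / (k + 1)) := by
          refine Finset.sum_le_sum fun i _ => ?_
          rw [norm_smul]
          exact mul_le_mul (norm_le_pi_norm c i) (hx i).le (norm_nonneg _) (norm_nonneg _)
      _ = (k / (k + 1)) * (t * ‖c‖) := by
          rw [Finset.sum_const, Finset.card_univ, Fintype.card_fin, nsmul_eq_mul]; ring
      _ ≤ 1 * (t * ‖c‖) := by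
          gcongr
          rw [div_le_one (by positivity)]; linarith
      _ = t * ‖c‖ := one_mul _
  have h4 : ι (Fintype.linearCombination ℂ x c) = ψ c + r := by rw [hr]; abel
  have h5 : (form (ψ c) r).re ≤ C * ‖c‖ * (t * ‖c‖) :=
    (Complex.re_le_norm _).trans ((norm_form_le _ _).trans
      (mul_le_mul (h2 c) h3 (norm_nonneg _) (by positivity)))
  have h6 : energy r ≤ (t * ‖c‖) ^ 2 :=
    (le_abs_self _).trans ((abs_energy_le r).trans (pow_le_pow_left₀ (norm_nonneg _) h3 2))
  have h7 := h1 c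
  have hc' : 0 < ‖c‖ ^ 2 := by have := norm_pos_iff.mpr hc; positivity
  simp only [h4, energy_add]
  have h8 : energy (ψ c) + 2 * (form (ψ c) r).re + energy r
      ≤ (-ε + (2 * C * t + t ^ 2)) * ‖c‖ ^ 2 := by
    nlinarith
  have h9 : 2 * C * t + t ^ 2 ≤ ε / 2 := by nlinarith
  nlinarith

theorem energy_sub_of_form_eq_zero {x y : X} (h : form (x - y) y = 0) :
    energy x = energy (x - y) + energy y := by
  have := energy_add (x - y) y
  rw [h] at this
  simpa using this

/-- A densely defined contraction between Pontryagin spaces of the same negative index extends to a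
bounded operator. Such a contraction carries a maximal negative subspace in its domain to a maximal
negative subspace, and both orthogonal companions are uniformly positive. -/
theorem exists_extension {k : ℕ} (hX : negIndex X = k) (hY : negIndex Y = k) [CompleteSpace Y]
    {ι : L →ₗ[ℂ] X} (hι : DenseRange ι) {T : L →ₗ[ℂ] Y}
    (hT : ∀ x, energy (T x) ≤ energy (ι x)) : ∃ S : X →L[ℂ] Y, ∀ x, S (ι x) = T x := by
  suffices h : ∃ C, ∀ x, ‖T x‖ ≤ C * ‖ι x‖ from
    ⟨T.extendOfNorm ι, fun x => LinearMap.extendOfNorm_eq hι h x⟩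
  obtain ⟨φ, hφ⟩ := HasNeg.of_denseRange hι (hasNeg_iff.mpr hX.ge)
  have hφ' : ∀ c, c ≠ 0 → energy ((T ∘ₗ φ) c) < 0 := fun c hc => (hT _).trans_lt (hφ c hc)
  obtain ⟨ε, hε, h1⟩ := energy_uniformly_neg (φ := ι ∘ₗ φ) hφ
  obtain ⟨C₁, hC₁, h2⟩ := exists_norm_le (ι ∘ₗ φ)
  obtain ⟨C₂, hC₂, h3⟩ := exists_norm_le (T ∘ₗ φ)
  obtain ⟨δ, hδ, h4⟩ := energy_uniformly_pos hY hφ'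
  obtain ⟨G₁, hG₁, -⟩ := exists_gram_inverse (h := formₗ X) (φ := ι ∘ₗ φ) hφ
  obtain ⟨G₂, hG₂, -⟩ := exists_gram_inverse (h := formₗ Y) hφ'
  simp only [LinearMap.comp_apply, formₗ_apply] at h1 h2 h3 h4 hG₁ hG₂
  -- the estimate on the companion of the negative subspace
  have key : ∃ C > 0, ∀ p : L, (∀ d, form (ι p) (ι (φ d)) = 0) → ‖T p‖ ≤ C * ‖ι p‖ := by
    refine ⟨√δ⁻¹ + C₂ * √ε⁻¹, by positivity, fun p hp => ?_⟩
    set d := G₂ (gram (formₗ Y) (T ∘ₗ φ) (T p)) with hd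
    have e1 : energy (T (p - φ d)) ≤ ‖ι p‖ ^ 2 - ε * ‖d‖ ^ 2 := by
      refine (hT _).trans ?_
      rw [map_sub, energy_sub, hp d]
      have := (le_abs_self _).trans (abs_energy_le (ι p))
      have := h1 d
      simp only [Complex.zero_re]
      linarith
    have e2 := h4 (T (p - φ d)) fun c => by rw [map_sub]; exact hG₂ (T p) c
    have e3 : ‖T (p - φ d)‖ ≤ √δ⁻¹ * ‖ι p‖ := by
      rw [← abs_of_nonneg (norm_nonneg (ι p)), ← Real.sqrt_sq_eq_abs, ← Real.sqrt_mul (by positivity)]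
      refine Real.le_sqrt_of_sq_le ?_
      rw [inv_mul_eq_div, le_div_iff₀ hδ]
      nlinarith [sq_nonneg ‖d‖]
    have e4 : ‖d‖ ≤ √ε⁻¹ * ‖ι p‖ := by
      rw [← abs_of_nonneg (norm_nonneg (ι p)), ← Real.sqrt_sq_eq_abs, ← Real.sqrt_mul (by positivity)]
      refine Real.le_sqrt_of_sq_le ?_
      rw [inv_mul_eq_div, le_div_iff₀ hε]
      nlinarith [sq_nonneg ‖T (p - φ d)‖]
    calc ‖T p‖ = ‖T (p - φ d) + T (φ d)‖ := by rw [map_sub]; congr 1; abel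
      _ ≤ √δ⁻¹ * ‖ι p‖ + C₂ * (√ε⁻¹ * ‖ι p‖) := by
          refine (norm_add_le _ _).trans (add_le_add e3 ((h3 d).trans ?_))
          gcongr
      _ = _ := by ring
  obtain ⟨C₃, hC₃, key⟩ := key
  refine ⟨C₃ * (1 + C₁ * (C₁ / ε)) + C₂ * (C₁ / ε), fun x => ?_⟩
  set c := G₁ (gram (formₗ X) (ι ∘ₗ φ) (ι x)) with hc
  have e1 : ∀ d, form (ι x - ι (φ c)) (ι (φ d)) = 0 := hG₁ (ι x)
  have e2 : ε * ‖c‖ ^ 2 ≤ ‖ι x‖ * (C₁ * ‖c‖) := by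
    have a1 := h1 c
    have a2 : form (ι x) (ι (φ c)) = form (ι (φ c)) (ι (φ c)) := by
      rw [← sub_eq_zero, ← form_sub_left]; exact e1 c
    have a3 : |energy (ι (φ c))| ≤ ‖ι x‖ * (C₁ * ‖c‖) := by
      rw [energy, ← a2]
      refine (Complex.abs_re_le_norm _).trans ((norm_form_le _ _).trans ?_)
      gcongr
      exact h2 c
    linarith [neg_abs_le (energy (ι (φ c)))]
  have e3 : ‖c‖ ≤ C₁ / ε * ‖ι x‖ := by
    rcases (norm_nonneg c).eq_or_lt with h0 | h0
    · rw [← h0]; positivity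
    · rw [div_mul_eq_mul_div, le_div_iff₀ hε]
      nlinarith
  have e4 : ‖ι (x - φ c)‖ ≤ (1 + C₁ * (C₁ / ε)) * ‖ι x‖ := by
    rw [map_sub]
    refine (norm_sub_le _ _).trans ?_
    have := h2 c
    nlinarith
  calc ‖T x‖ = ‖T (x - φ c) + T (φ c)‖ := by rw [map_sub]; congr 1; abel
    _ ≤ C₃ * ((1 + C₁ * (C₁ / ε)) * ‖ι x‖) + C₂ * (C₁ / ε * ‖ι x‖) := by
        refine (norm_add_le _ _).trans (add_le_add ((key _ ?_).trans ?_) ((h3 c).trans ?_))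
        · intro d; rw [map_sub]; exact e1 d
        · gcongr
        · gcongr
    _ = _ := by ring

theorem energy_le_of_dense {ι : L →ₗ[ℂ] X} (hι : DenseRange ι) {S : X →L[ℂ] Y}
    (h : ∀ x, energy (S (ι x)) ≤ energy (ι x)) (x : X) : energy (S x) ≤ energy x :=
  hι.induction_on (p := fun x => energy (S x) ≤ energy x) x
    (isClosed_le (continuous_energy.comp S.continuous) continuous_energy) h

/-- The adjoint of a contraction between Pontryagin spaces of the same negative index is a
contraction: a vector `y` violating this would give the negative subspace of vectors
`T x + t (y - T T* y)`, of dimension one more than the negative index. -/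
theorem energy_adj_le [CompleteSpace X] [CompleteSpace Y] (hXY : negIndex X = negIndex Y)
    {T : X →L[ℂ] Y} (hT : ∀ x, energy (T x) ≤ energy x) (y : Y) :
    energy (adj T y) ≤ energy y := by
  by_contra! hlt
  obtain ⟨φ, hφ⟩ := hasNeg_iff.mpr (le_refl (negIndex X))
  set z := adj T y with hz
  have h : HasNeg (energy : Y → ℝ) (Module.finrank ℂ ((Fin (negIndex X) → ℂ) × ℂ)) := by
    refine hasNeg_of_linearMap
      (((T : X →ₗ[ℂ] Y) ∘ₗ φ).coprod (LinearMap.toSpanSingleton ℂ Y (y - T z))) ?_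
    rintro ⟨c, t⟩ hc
    have e1 : energy (T (φ c - t • z) + t • y) ≤ energy (φ c) + ‖t‖ ^ 2 * (energy y - energy z) := by
      have a1 := hT (φ c - t • z)
      have a2 : (form (φ c - t • z) (t • z)).re
          = (form (φ c) (t • z)).re - ‖t‖ ^ 2 * energy z := by
        rw [form_sub_left, Complex.sub_re, ← energy_smul]; rfl
      rw [energy_add, form_adj, ContinuousLinearMap.map_smul (adj T), ← hz, a2, energy_smul]
      rw [energy_sub, energy_smul] at a1
      linarith
    have e2 : T (φ c) + t • (y - T z) = T (φ c - t • z) + t • y := by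
      simp only [map_sub, map_smul, smul_sub]; abel
    simp only [LinearMap.coprod_apply, LinearMap.toSpanSingleton_apply, LinearMap.comp_apply,
      ContinuousLinearMap.coe_coe]
    rw [e2]
    refine e1.trans_lt ?_
    by_cases ht : t = 0
    · have hc' : c ≠ 0 := fun h0 => hc (by simp [ht, h0])
      simpa [ht] using hφ c hc'
    · have h2 : energy (φ c) ≤ 0 := by
        by_cases hc' : c = 0
        · simp [hc']
        · exact (hφ c hc').le
      have : 0 < ‖t‖ ^ 2 := by positivity
      nlinarith
  have := hasNeg_iff.mp h
  simp at this
  omega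

/-- In the strong topology, the norm is controlled by the energy together with finitely many
functionals. -/
theorem exists_norm_sq_le {k : ℕ} (hk : negIndex X = k) {φ : (Fin k → ℂ) →ₗ[ℂ] X}
    (hφ : ∀ c, c ≠ 0 → energy (φ c) < 0) :
    ∃ C > 0, ∀ x, ‖x‖ ^ 2 ≤ C * (|energy x| + ‖gram (formₗ X) φ x‖ ^ 2) := by
  obtain ⟨G, hG, -⟩ := exists_gram_inverse (h := formₗ X) hφ
  obtain ⟨ε, hε, h1⟩ := energy_uniformly_pos hk hφ
  obtain ⟨C, hC, h2⟩ := exists_norm_le (φ ∘ₗ G)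
  refine ⟨2 * (ε⁻¹ * (1 + C ^ 2) + C ^ 2), by positivity, fun x => ?_⟩
  set g := gram (formₗ X) φ x
  set m := φ (G g) with hm
  have e1 : ‖m‖ ^ 2 ≤ C ^ 2 * ‖g‖ ^ 2 := by
    rw [← mul_pow]; exact pow_le_pow_left₀ (norm_nonneg _) (h2 g) 2
  have e2 : energy x = energy (x - m) + energy m := energy_sub_of_form_eq_zero (hG x (G g))
  have e3 : ε * ‖x - m‖ ^ 2 ≤ energy (x - m) := h1 _ (hG x)
  have e4 := neg_abs_le (energy m)
  have e5 := abs_energy_le m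
  have e6 := le_abs_self (energy x)
  have e7 : ‖x - m‖ ^ 2 ≤ ε⁻¹ * (|energy x| + C ^ 2 * ‖g‖ ^ 2) := by
    rw [inv_mul_eq_div, le_div_iff₀ hε]; linarith
  have e8 : ‖x‖ ^ 2 ≤ 2 * (‖x - m‖ ^ 2 + ‖m‖ ^ 2) := by
    have : ‖x‖ ≤ ‖x - m‖ + ‖m‖ := by
      calc ‖x‖ = ‖(x - m) + m‖ := by congr 1; abel
        _ ≤ _ := norm_add_le _ _
    nlinarith [norm_nonneg x, sq_nonneg (‖x - m‖ - ‖m‖)]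
  have : 0 ≤ ε⁻¹ := by positivity
  have i1 : 0 ≤ ε⁻¹ * ‖g‖ ^ 2 := by positivity
  have i2 : 0 ≤ ε⁻¹ * (C ^ 2 * |energy x|) := by positivity
  have i3 : 0 ≤ C ^ 2 * |energy x| := by positivity
  nlinarith

/-- A subspace is dense exactly when nothing is orthogonal to it in the indefinite inner product. -/
theorem topologicalClosure_eq_top_iff [CompleteSpace X] (S : Submodule ℂ X) :
    S.topologicalClosure = ⊤ ↔ ∀ x, (∀ s ∈ S, form x s = 0) → x = 0 := by
  rw [Submodule.topologicalClosure_eq_top_iff, Submodule.eq_bot_iff]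
  have key : ∀ x, (∀ s ∈ S, form x s = 0) ↔ J x ∈ Sᗮ := fun x => by
    rw [Submodule.mem_orthogonal]; rfl
  constructor
  · intro h x hx
    rw [← J_invol x, h _ ((key x).mp hx), map_zero]
  · intro h x hx
    rw [← J_invol x, h (J x) ((key _).mpr (by rwa [J_invol])), map_zero]

end Extension
/-! ### Orthogonal direct sums -/

section Product

variable {X : Type u} [NormedAddCommGroup X] [InnerProductSpace ℂ X] [PontryaginSpace X]
variable {Y : Type v} [NormedAddCommGroup Y] [InnerProductSpace ℂ Y] [PontryaginSpace Y]

variable (X Y) in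
/-- The inclusion of the first summand. -/
noncomputable def prodInl : X →L[ℂ] WithLp 2 (X × Y) :=
  (WithLp.prodContinuousLinearEquiv 2 ℂ X Y).symm.toContinuousLinearMap ∘L
    ContinuousLinearMap.inl ℂ X Y

variable (X Y) in
/-- The inclusion of the second summand. -/
noncomputable def prodInr : Y →L[ℂ] WithLp 2 (X × Y) :=
  (WithLp.prodContinuousLinearEquiv 2 ℂ X Y).symm.toContinuousLinearMap ∘L
    ContinuousLinearMap.inr ℂ X Y

omit [PontryaginSpace X] [PontryaginSpace Y] in
theorem toLp_eq_add (x : X) (y : Y) :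
    (WithLp.toLp 2 (x, y) : WithLp 2 (X × Y)) = prodInl X Y x + prodInr X Y y := by
  change _ = WithLp.toLp 2 (x, 0) + WithLp.toLp 2 (0, y)
  rw [← WithLp.toLp_add]; simp

variable (X Y) in
/-- The direct sum of the fundamental symmetries. -/
noncomputable def prodJ : WithLp 2 (X × Y) →L[ℂ] WithLp 2 (X × Y) :=
  (WithLp.prodContinuousLinearEquiv 2 ℂ X Y).symm.toContinuousLinearMap ∘L
    (J.prodMap J) ∘L (WithLp.prodContinuousLinearEquiv 2 ℂ X Y).toContinuousLinearMap

theorem prodJ_apply (p : WithLp 2 (X × Y)) : prodJ X Y p = WithLp.toLp 2 (J p.fst, J p.snd) := rfl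

variable (X Y) in
/-- The `-1`-eigenspace of a direct sum of fundamental symmetries. -/
noncomputable def kerProdJEquiv :
    LinearMap.ker ((prodJ X Y + 1 : WithLp 2 (X × Y) →L[ℂ] WithLp 2 (X × Y)) :
      WithLp 2 (X × Y) →ₗ[ℂ] WithLp 2 (X × Y)) ≃ₗ[ℂ]
    (LinearMap.ker ((J + 1 : X →L[ℂ] X) : X →ₗ[ℂ] X) ×
      LinearMap.ker ((J + 1 : Y →L[ℂ] Y) : Y →ₗ[ℂ] Y)) where
  toFun p := (⟨p.1.fst, congrArg WithLp.fst p.2⟩, ⟨p.1.snd, congrArg WithLp.snd p.2⟩)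
  invFun p := ⟨WithLp.toLp 2 (p.1.1, p.2.1), by
    have h1 : J p.1.1 + p.1.1 = 0 := p.1.2
    have h2 : J p.2.1 + p.2.1 = 0 := p.2.2
    change prodJ X Y _ + _ = 0
    rw [prodJ_apply, ← WithLp.toLp_add]
    simp [h1, h2]⟩
  map_add' p q := rfl
  map_smul' a p := rfl
  left_inv p := rfl
  right_inv p := rfl

/-- The orthogonal direct sum of two Pontryagin spaces. -/
noncomputable instance instProd : PontryaginSpace (WithLp 2 (X × Y)) where
  J := prodJ X Y
  J_symm p q := by simp [WithLp.prod_inner_apply, prodJ_apply, J_symm]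
  J_invol p := by
    change WithLp.toLp 2 (J (J p.fst), J (J p.snd)) = p
    rw [J_invol, J_invol]; rfl
  finite_neg := Module.Finite.equiv (kerProdJEquiv X Y).symm

theorem negIndex_prod : negIndex (WithLp 2 (X × Y)) = negIndex X + negIndex Y := by
  unfold negIndex
  rw [← Module.finrank_prod]
  exact (kerProdJEquiv X Y).finrank_eq

theorem form_prod (p q : WithLp 2 (X × Y)) :
    form p q = form p.fst q.fst + form p.snd q.snd := rfl

theorem energy_prod (p : WithLp 2 (X × Y)) : energy p = energy p.fst + energy p.snd := by
  rw [energy, form_prod, Complex.add_re]; rfl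

end Product

/-! ### Completion of a Hermitian form with finitely many negative squares -/

section Completion

open scoped ComplexConjugate

variable {L : Type w} [AddCommGroup L] [Module ℂ L]

/-- A Hermitian form with exactly `κ` negative squares has a Pontryagin space completion of negative
index `κ`. Changing the sign of the form on a maximal negative subspace gives a positive
semidefinite form, whose Hilbert space completion carries the change of sign as its fundamental
symmetry. -/
theorem exists_completion {h : L →ₗ[ℂ] L →ₗ⋆[ℂ] ℂ} (hs : ∀ x y, conj (h x y) = h y x) {κ : ℕ}
    (h₁ : HasNeg (quad h) κ) (h₂ : ¬HasNeg (quad h) (κ + 1)) :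
    ∃ (P : Type w) (_ : NormedAddCommGroup P) (_ : InnerProductSpace ℂ P) (_ : CompleteSpace P)
      (_ : PontryaginSpace P) (ι : L →ₗ[ℂ] P),
      DenseRange ι ∧ (∀ x y, form (ι x) (ι y) = h x y) ∧ negIndex P = κ := by
  obtain ⟨φ, hφ⟩ := h₁
  obtain ⟨G, hG, hG'⟩ := exists_gram_inverse hφ
  -- the orthogonal projection onto the negative subspace, and the associated reflection
  set π : L →ₗ[ℂ] L := φ ∘ₗ G ∘ₗ gram h φ with hπ
  have hπ₁ : ∀ x y, h (x - π x) (π y) = 0 := fun x y => hG x _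
  have hππ : ∀ x, π (π x) = π x := fun x => by
    simp only [hπ, LinearMap.comp_apply]; rw [hG']
  have hπ₂ : ∀ x y, h (π x) y = h x (π y) := by
    intro x y
    have a := hπ₁ x y
    have b := congrArg conj (hπ₁ y x)
    rw [map_zero, hs, map_sub] at b
    rw [map_sub, LinearMap.sub_apply] at a
    rw [sub_eq_zero.mp a, sub_eq_zero.mp b]
  set R : L →ₗ[ℂ] L := LinearMap.id - (2 : ℂ) • π with hR
  have hR₀ : ∀ x, R x = x - (2 : ℂ) • π x := fun x => rfl
  have hRR : ∀ x, R (R x) = x := fun x => by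
    simp only [hR₀, map_sub, map_smul, hππ]; module
  have hR₁ : ∀ x y, h (R x) y = h x (R y) := by
    intro x y
    simp only [hR₀, map_sub, map_smul, LinearMap.sub_apply, LinearMap.smul_apply,
      LinearMap.map_smulₛₗ, hπ₂, Complex.conj_ofNat]
  have hpos : ∀ x, 0 ≤ (h (R x) x).re := by
    intro x
    have e1 : h (R x) x = h (x - π x) (x - π x) - h (π x) (π x) := by
      have a := hπ₁ x x
      have b : h (π x) x = h (π x) (π x) := by rw [hπ₂, hπ₂, hππ]
      rw [map_sub (h (x - π x)), a, hR₀]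
      simp only [map_sub, map_smul, LinearMap.sub_apply, LinearMap.smul_apply, b, smul_eq_mul]
      ring
    have e2 : 0 ≤ quad h (x - π x) := by
      by_contra! hlt
      exact h₂ (HasNeg.succ hs hφ (fun d => hG x d) hlt)
    have e3 : quad h (π x) ≤ 0 := by
      by_cases hc : G (gram h φ x) = 0
      · simp [hπ, hc, quad]
      · exact (hφ _ hc).le
    rw [e1, Complex.sub_re]
    exact sub_nonneg.mpr (e3.trans e2)
  let core : PreInnerProductSpace.Core ℂ L :=
    { inner := fun x y => h (R y) x
      conj_inner_symm := fun x y => by rw [hs, hR₁]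
      re_inner_nonneg := fun x => hpos x
      add_left := fun x y z => map_add _ _ _
      smul_left := fun x y r => by rw [LinearMap.map_smulₛₗ]; rfl }
  let _ : SeminormedAddCommGroup L :=
    @InnerProductSpace.Core.toSeminormedAddCommGroup ℂ L _ _ _ core
  let _ : InnerProductSpace ℂ L := InnerProductSpace.ofCore core
  have hinner : ∀ x y : L, inner ℂ x y = h (R y) x := fun x y => rfl
  let ι : L →L[ℂ] UniformSpace.Completion L := UniformSpace.Completion.toComplL
  have hι : DenseRange ι := UniformSpace.Completion.denseRange_coe
  have hι' : ∀ x y, inner ℂ (ι x) (ι y) = h (R y) x := fun x y =>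
    UniformSpace.Completion.inner_coe x y
  have hnorm : ∀ x, ‖ι (R x)‖ = ‖ι x‖ := fun x => by
    have : ‖ι (R x)‖ ^ 2 = ‖ι x‖ ^ 2 := by
      rw [← inner_self_eq_norm_sq (𝕜 := ℂ), ← inner_self_eq_norm_sq (𝕜 := ℂ), hι', hι', hRR, hR₁]
    exact (sq_eq_sq₀ (norm_nonneg _) (norm_nonneg _)).mp this
  let S : UniformSpace.Completion L →L[ℂ] UniformSpace.Completion L :=
    ((ι : L →ₗ[ℂ] UniformSpace.Completion L) ∘ₗ R).extendOfNorm
      (ι : L →ₗ[ℂ] UniformSpace.Completion L)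
  have hS : ∀ x, S (ι x) = ι (R x) := fun x =>
    LinearMap.extendOfNorm_eq (f := (ι : L →ₗ[ℂ] UniformSpace.Completion L) ∘ₗ R)
      (e := (ι : L →ₗ[ℂ] UniformSpace.Completion L)) hι ⟨1, fun y => by simp [hnorm]⟩ x
  have hSS : ∀ x, S (S x) = x := fun x =>
    hι.induction_on (p := fun x => S (S x) = x) x
      (isClosed_eq (by fun_prop) continuous_id) fun y => by rw [hS, hS, hRR]
  have hSsymm : ∀ x y, inner ℂ (S x) y = (inner ℂ x (S y) : ℂ) := fun x y => by
    refine hι.induction_on₂ (p := fun x y => inner ℂ (S x) y = (inner ℂ x (S y) : ℂ))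
      (isClosed_eq (by fun_prop) (by fun_prop)) (fun a b => ?_) x y
    rw [hS, hS, hι', hι', hRR, hR₁, hRR]
  -- the negative part of the reflection lies in the completion of the negative subspace
  have hker : LinearMap.ker ((S + 1 : _ →L[ℂ] UniformSpace.Completion L) :
      UniformSpace.Completion L →ₗ[ℂ] UniformSpace.Completion L) ≤
      LinearMap.range ((ι : L →ₗ[ℂ] UniformSpace.Completion L) ∘ₗ φ) := by
    set V := LinearMap.range ((ι : L →ₗ[ℂ] UniformSpace.Completion L) ∘ₗ φ) with hV
    have hclosed : IsClosed (V : Set (UniformSpace.Completion L)) :=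
      Submodule.closed_of_finiteDimensional V
    have hmem : ∀ x, x - S x ∈ V := fun x =>
      hι.induction_on (p := fun x => x - S x ∈ V) x
        (hclosed.preimage (by fun_prop)) fun y => by
          refine ⟨(2 : ℂ) • G (gram h φ y), ?_⟩
          rw [hS, ← map_sub, hR₀, sub_sub_cancel]
          simp [hπ]
    intro x hx
    have h1 : S x + x = 0 := hx
    have h2 : x - S x = (2 : ℂ) • x := by rw [eq_neg_of_add_eq_zero_left h1]; module
    have h3 := V.smul_mem (2 : ℂ)⁻¹ (h2 ▸ hmem x)
    rwa [smul_smul, inv_mul_cancel₀ two_ne_zero, one_smul] at h3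
  let _ : PontryaginSpace (UniformSpace.Completion L) :=
    { J := S
      J_symm := hSsymm
      J_invol := hSS
      finite_neg := Submodule.finiteDimensional_of_le hker }
  have hform : ∀ x y, form (ι x) (ι y) = h x y := fun x y => by
    change inner ℂ (ι y) (S (ι x)) = _
    rw [hS, hι', hRR]
  refine ⟨UniformSpace.Completion L, inferInstance, inferInstance, inferInstance, inferInstance,
    (ι : L →ₗ[ℂ] UniformSpace.Completion L), hι, hform, le_antisymm ?_ ?_⟩
  · by_contra! hlt
    have := HasNeg.of_denseRange (ι := (ι : L →ₗ[ℂ] UniformSpace.Completion L)) hι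
      (hasNeg_iff.mpr hlt)
    refine h₂ (this.map LinearMap.id fun x => le_of_eq ?_)
    exact congrArg Complex.re (hform x x).symm
  · refine hasNeg_iff.mp ⟨(ι : L →ₗ[ℂ] UniformSpace.Completion L) ∘ₗ φ, fun c hc => ?_⟩
    have : energy (ι (φ c)) = quad h (φ c) := congrArg Complex.re (hform _ _)
    exact this.trans_lt (hφ c hc)

end Completion
/-! ### Indefinite adjoints and isometries -/

section Adjoint

variable {X : Type u} [NormedAddCommGroup X] [InnerProductSpace ℂ X] [CompleteSpace X]
  [PontryaginSpace X]
variable {Y : Type v} [NormedAddCommGroup Y] [InnerProductSpace ℂ Y] [CompleteSpace Y]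
  [PontryaginSpace Y]

theorem adj_eq_of_form {T : X →L[ℂ] Y} {S : Y →L[ℂ] X}
    (h : ∀ x y, form (T x) y = form x (S y)) : adj T = S := by
  ext y
  rw [← sub_eq_zero]
  refine eq_zero_of_form fun x => form_comm_zero ?_
  rw [form_sub_right, ← form_adj, h, sub_self]

theorem form_adj' (T : X →L[ℂ] Y) (x : X) (y : Y) : form (adj T y) x = form y (T x) := by
  rw [← form_conj, ← form_adj, form_conj]

@[simp] theorem adj_adj (T : X →L[ℂ] Y) : adj (adj T) = T :=
  adj_eq_of_form fun y x => form_adj' T x y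

theorem adj_comp {Z : Type*} [NormedAddCommGroup Z] [InnerProductSpace ℂ Z] [CompleteSpace Z]
    [PontryaginSpace Z] (S : Y →L[ℂ] Z) (T : X →L[ℂ] Y) : adj (S ∘L T) = adj T ∘L adj S :=
  adj_eq_of_form fun x y => by simp [form_adj]

theorem adj_pow (T : X →L[ℂ] X) (n : ℕ) : adj (T ^ n) = adj T ^ n := by
  induction n with
  | zero => exact adj_eq_of_form fun x y => rfl
  | succ n ih => rw [pow_succ, pow_succ', ← ih]; exact adj_comp _ _

theorem adj_add (S T : X →L[ℂ] Y) : adj (S + T) = adj S + adj T :=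
  adj_eq_of_form fun x y => by simp [form_add_left, form_add_right, form_adj]

theorem adj_sub (S T : X →L[ℂ] Y) : adj (S - T) = adj S - adj T :=
  adj_eq_of_form fun x y => by simp [form_sub_left, form_sub_right, form_adj]

theorem adj_smul (a : ℂ) (T : X →L[ℂ] Y) : adj (a • T) = (starRingEnd ℂ) a • adj T :=
  adj_eq_of_form fun x y => by simp [form_smul_left, form_smul_right, form_adj]

theorem adj_one : adj (1 : X →L[ℂ] X) = 1 := adj_eq_of_form fun _ _ => rfl

theorem adj_inverse {T : X →L[ℂ] X} (hT : IsUnit T) :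
    adj (Ring.inverse T) = Ring.inverse (adj T) := by
  have h1 : adj T * adj (Ring.inverse T) = 1 := by
    have := congrArg adj (Ring.inverse_mul_cancel _ hT)
    rw [adj_one] at this
    rw [← this]; exact (adj_comp _ _).symm
  have h2 : adj (Ring.inverse T) * adj T = 1 := by
    have := congrArg adj (Ring.mul_inverse_cancel _ hT)
    rw [adj_one] at this
    rw [← this]; exact (adj_comp _ _).symm
  exact (Ring.inverse_unit (⟨adj T, adj (Ring.inverse T), h1, h2⟩ : (X →L[ℂ] X)ˣ)).symm

theorem continuous_adj : Continuous (adj : (X →L[ℂ] Y) → (Y →L[ℂ] X)) := by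
  unfold adj
  have := (ContinuousLinearMap.adjoint (𝕜 := ℂ) (E := X) (F := Y)).continuous
  fun_prop

end Adjoint

section Polarization

variable {X : Type u} [NormedAddCommGroup X] [InnerProductSpace ℂ X] [PontryaginSpace X]
variable {Y : Type v} [NormedAddCommGroup Y] [InnerProductSpace ℂ Y] [PontryaginSpace Y]

theorem form_eq_of_energy {V : X →L[ℂ] Y} (h : ∀ x, energy (V x) = energy x) (x y : X) :
    form (V x) (V y) = form x y := by
  have hre : ∀ x y, (form (V x) (V y)).re = (form x y).re := fun x y => by
    have h1 := h (x + y)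
    rw [map_add, energy_add, energy_add, h, h] at h1
    linarith
  refine Complex.ext (hre x y) ?_
  have h2 := hre x (Complex.I • y)
  rw [map_smul, form_smul_right, form_smul_right] at h2
  simpa using h2

theorem injective_of_energy {V : X →L[ℂ] Y} (h : ∀ x, energy (V x) = energy x) :
    Function.Injective V := by
  rw [injective_iff_map_eq_zero]
  intro x hx
  refine eq_zero_of_form fun y => ?_
  rw [← form_eq_of_energy h, hx, form_zero_left]

end Polarization

/-! ### Separability and the size of state spaces -/

theorem separableSpace_of_denseRange {U : Type u} [NormedAddCommGroup U] [InnerProductSpace ℂ U]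
    [TopologicalSpace.SeparableSpace U] {X : Type v} [NormedAddCommGroup X] [InnerProductSpace ℂ X]
    {j : (ℕ →₀ U) →ₗ[ℂ] X} (hj : DenseRange j)
    (hc : ∀ n, Continuous fun u => j (Finsupp.single n u)) : TopologicalSpace.SeparableSpace X := by
  have h1 : TopologicalSpace.IsSeparable (⋃ n, Set.range fun u => j (Finsupp.single n u)) :=
    .iUnion fun n => TopologicalSpace.isSeparable_range (hc n)
  have h2 := (h1.span (R := ℂ)).closure
  rw [← TopologicalSpace.isSeparable_univ_iff]
  refine h2.mono fun x _ => ?_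
  refine closure_mono ?_ (hj x)
  rintro _ ⟨ξ, rfl⟩
  induction ξ using Finsupp.induction_linear with
  | zero => simp
  | add f g hf hg => rw [map_add]; exact Submodule.add_mem _ hf hg
  | single n u => exact Submodule.subset_span (Set.mem_iUnion.mpr ⟨n, u, rfl⟩)

/-- A separable Hilbert space has a copy in every universe, since its vectors are determined by their
inner products with a dense sequence. -/
theorem small_of_separable (H : Type v) [NormedAddCommGroup H] [InnerProductSpace ℂ H]
    [TopologicalSpace.SeparableSpace H] : Small.{w} H := by
  refine small_of_injective (β := ULift.{w} (ℕ → ℂ))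
    (f := fun x => ULift.up fun n => inner ℂ (TopologicalSpace.denseSeq H n) x) fun x y hxy => ?_
  have h : ∀ n, inner ℂ (TopologicalSpace.denseSeq H n) x
      = (inner ℂ (TopologicalSpace.denseSeq H n) y : ℂ) := fun n =>
    congrFun (congrArg ULift.down hxy) n
  refine ext_inner_left ℂ fun v => ?_
  have h' : (fun v => inner ℂ v x) = fun v => (inner ℂ v y : ℂ) :=
    (TopologicalSpace.denseRange_denseSeq H).equalizer (by fun_prop) (by fun_prop) (funext h)
  exact congrFun h' v

open scoped ComplexConjugate

/-- The pullback of a sesquilinear form along a linear map. -/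
noncomputable def pullback {L M : Type*} [AddCommGroup L] [Module ℂ L] [AddCommGroup M]
    [Module ℂ M] (h : M →ₗ[ℂ] M →ₗ⋆[ℂ] ℂ) (R : L →ₗ[ℂ] M) : L →ₗ[ℂ] L →ₗ⋆[ℂ] ℂ :=
  LinearMap.mk₂'ₛₗ (RingHom.id ℂ) (starRingEnd ℂ) (fun x y => h (R x) (R y))
    (by simp) (by simp) (by simp) (by simp)

/-- The completion of a Hermitian form with `κ` negative squares, placed in any universe in which
the underlying space has a copy. -/
theorem exists_completion_of_small {L : Type v} [AddCommGroup L] [Module ℂ L] [Small.{w} L]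
    {h : L →ₗ[ℂ] L →ₗ⋆[ℂ] ℂ} (hs : ∀ x y, conj (h x y) = h y x) {κ : ℕ}
    (h₁ : HasNeg (quad h) κ) (h₂ : ¬HasNeg (quad h) (κ + 1)) :
    ∃ (P : Type w) (_ : NormedAddCommGroup P) (_ : InnerProductSpace ℂ P) (_ : CompleteSpace P)
      (_ : PontryaginSpace P) (ι : L →ₗ[ℂ] P),
      DenseRange ι ∧ (∀ x y, form (ι x) (ι y) = h x y) ∧ negIndex P = κ := by
  let e := Shrink.linearEquiv.{w} ℂ L
  obtain ⟨P, i1, i2, i3, i4, ι, hι, hf, hκ⟩ := exists_completion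
    (h := pullback h e.toLinearMap) (fun x y => hs _ _) (κ := κ)
    (h₁.map e.symm.toLinearMap fun x => by
      change (h (e (e.symm x)) (e (e.symm x))).re ≤ _
      rw [e.apply_symm_apply]; exact le_rfl)
    (fun hn => h₂ (hn.map e.toLinearMap fun x => le_rfl))
  refine ⟨P, i1, i2, i3, i4, ι ∘ₗ e.symm.toLinearMap, ?_, fun x y => ?_, hκ⟩
  · rw [DenseRange, LinearMap.coe_comp, LinearEquiv.coe_coe, e.symm.surjective.range_comp]
    exact hι
  · rw [LinearMap.comp_apply, LinearMap.comp_apply, hf]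
    change h (e (e.symm x)) (e (e.symm y)) = _
    rw [e.apply_symm_apply, e.apply_symm_apply]

theorem hasNeg_zero {L : Type*} [AddCommGroup L] [Module ℂ L] (q : L → ℝ) : HasNeg q 0 :=
  ⟨0, fun c hc => (hc (Subsingleton.elim c 0)).elim⟩

theorem exists_maximal_hasNeg {L : Type*} [AddCommGroup L] [Module ℂ L] {q : L → ℝ} {N : ℕ}
    (h : ¬HasNeg q (N + 1)) : ∃ k ≤ N, HasNeg q k ∧ ¬HasNeg q (k + 1) := by
  classical
  have hex : ∃ k, ¬HasNeg q (k + 1) := ⟨N, h⟩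
  refine ⟨Nat.find hex, Nat.find_min' hex h, ?_, Nat.find_spec hex⟩
  rcases hk : Nat.find hex with _ | m
  · exact hasNeg_zero q
  · have := Nat.find_min hex (m := m) (by omega)
    simpa using this

/-! ### Reachable states and the coefficients of the transfer function -/

namespace LinSystem

variable {U : Type u} [NormedAddCommGroup U] [InnerProductSpace ℂ U]
variable {Y : Type v} [NormedAddCommGroup Y] [InnerProductSpace ℂ Y]

/-- The map `(uₖ) ↦ ∑ Aᵏ B uₖ` on finitely supported input sequences. -/
noncomputable def reachMap (S : LinSystem.{w} U Y) : (ℕ →₀ U) →ₗ[ℂ] S.X :=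
  Finsupp.lsum ℂ fun n => (((S.A ^ n) ∘L S.B : U →L[ℂ] S.X) : U →ₗ[ℂ] S.X)

@[simp] theorem reachMap_single (S : LinSystem.{w} U Y) (n : ℕ) (x : U) :
    S.reachMap (Finsupp.single n x) = (S.A ^ n) (S.B x) := by
  rw [reachMap, Finsupp.lsum_single]; rfl

theorem reachMap_sum_single (S : LinSystem.{w} U Y) (n : ℕ) (a : ℕ → U) :
    S.reachMap (∑ k ∈ Finset.range (n + 1), Finsupp.single k (a k)) = S.reach n a := by
  rw [map_sum, reach]
  exact Finset.sum_congr rfl fun k _ => S.reachMap_single k (a k)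

theorem reachMap_eq_reach (S : LinSystem.{w} U Y) (ξ : ℕ →₀ U) :
    S.reachMap ξ = S.reach (ξ.support.sup id) ξ := by
  rw [← reachMap_sum_single]
  congr 1
  ext k
  rw [Finsupp.finsetSum_apply]
  simp only [Finsupp.single_apply, Finset.sum_ite_eq', Finset.mem_range]
  split_ifs with hk
  · rfl
  · by_contra hne
    have := Finset.le_sup (f := id) (Finsupp.mem_support_iff.mpr hne)
    simp only [id] at this
    omega

theorem isControllable_iff (S : LinSystem.{w} U Y) : S.IsControllable ↔ DenseRange S.reachMap := by
  have h : (⨆ n : ℕ, LinearMap.range (((S.A ^ n) ∘L S.B : U →L[ℂ] S.X) : U →ₗ[ℂ] S.X))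
      = LinearMap.range S.reachMap := by
    apply le_antisymm
    · refine iSup_le fun n => ?_
      rintro _ ⟨x, rfl⟩
      exact ⟨Finsupp.single n x, S.reachMap_single n x⟩
    · rintro _ ⟨ξ, rfl⟩
      induction ξ using Finsupp.induction_linear with
      | zero => simp
      | add f g hf hg => rw [map_add]; exact Submodule.add_mem _ hf hg
      | single n x => exact Submodule.mem_iSup_of_mem n ⟨x, (S.reachMap_single n x).symm⟩
  rw [IsControllable, h, ← Submodule.dense_iff_topologicalClosure_eq_top, DenseRange,
    LinearMap.coe_range]

/-- The delay of an input sequence by one step. -/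
noncomputable def delay (U : Type u) [NormedAddCommGroup U] [InnerProductSpace ℂ U] :
    (ℕ →₀ U) →ₗ[ℂ] (ℕ →₀ U) :=
  Finsupp.lmapDomain U ℂ Nat.succ

@[simp] theorem delay_single (n : ℕ) (x : U) :
    delay U (Finsupp.single n x) = Finsupp.single (n + 1) x := by
  simp [delay]

theorem reachMap_delay (S : LinSystem.{w} U Y) (ξ : ℕ →₀ U) :
    S.reachMap (delay U ξ) = S.A (S.reachMap ξ) := by
  induction ξ using Finsupp.induction_linear with
  | zero => simp
  | add f g hf hg => simp only [map_add, hf, hg]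
  | single n x => rw [delay_single, reachMap_single, reachMap_single, pow_succ']; rfl

section Realization

variable {S T : LinSystem.{w} U Y} {θ : ℂ → (U →L[ℂ] Y)}

theorem eventually_norm_smul_lt (A : S.X →L[ℂ] S.X) : ∀ᶠ z in 𝓝 (0 : ℂ), ‖z • A‖ < 1 := by
  have : Filter.Tendsto (fun z : ℂ => ‖z • A‖) (𝓝 0) (𝓝 0) := by
    have h : Continuous fun z : ℂ => ‖z • A‖ := by fun_prop
    simpa using h.tendsto 0
  exact this.eventually_lt_const one_pos

theorem isUnit_one_sub {A : S.X →L[ℂ] S.X} (h : ‖A‖ < 1) : IsUnit (1 - A) :=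
  (Units.oneSub A h).isUnit

theorem transfer_eq_tsum {z : ℂ} (h : ‖z • S.A‖ < 1) :
    S.transfer z = S.D + z • ∑' n : ℕ, z ^ n • (S.C ∘L (S.A ^ n) ∘L S.B) := by
  have h1 : HasSum (fun n => (z • S.A) ^ n) (Ring.inverse (1 - z • S.A)) := by
    rw [NormedRing.inverse_one_sub _ h]
    exact (summable_geometric_of_norm_lt_one h).hasSum
  let F : (S.X →L[ℂ] S.X) →L[ℂ] (U →L[ℂ] Y) :=
    (ContinuousLinearMap.compL ℂ U S.X Y S.C) ∘L ((ContinuousLinearMap.compL ℂ U S.X S.X).flip S.B)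
  have h2 : HasSum (fun n => z ^ n • (S.C ∘L (S.A ^ n) ∘L S.B))
      (S.C ∘L Ring.inverse (1 - z • S.A) ∘L S.B) := by
    have h3 := F.hasSum h1
    refine h3.congr_fun fun n => ?_
    rw [smul_pow, map_smul]
    rfl
  rw [h2.tsum_eq, transfer]

/-- The parameters `D` and `C Aⁿ B` determine the germ of the transfer function at `0`. -/
theorem IsRealization.of_markov (hT : T.IsRealization θ) (hD : S.D = T.D)
    (h : ∀ n, S.C ∘L (S.A ^ n) ∘L S.B = T.C ∘L (T.A ^ n) ∘L T.B) : S.IsRealization θ := by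
  filter_upwards [hT, eventually_norm_smul_lt S.A, eventually_norm_smul_lt T.A] with z h1 h2 h3
  rw [← h1, transfer_eq_tsum h2, transfer_eq_tsum h3, hD]
  simp only [h]

theorem eventuallyEq_of_smul {E : Type*} [NormedAddCommGroup E] [NormedSpace ℂ E] {f g : ℂ → E}
    (hf : ContinuousAt f 0) (hg : ContinuousAt g 0) (h : ∀ᶠ z in 𝓝 (0 : ℂ), z • f z = z • g z) :
    f =ᶠ[𝓝 0] g := by
  rw [← hf.eventuallyEq_nhds_iff_eventuallyEq_nhdsNE hg]
  filter_upwards [nhdsWithin_le_nhds h, self_mem_nhdsWithin] with z hz hz0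
  exact smul_right_injective E (show z ≠ 0 from hz0) hz

theorem continuousAt_resolvent (A : S.X →L[ℂ] S.X) :
    ContinuousAt (fun z : ℂ => Ring.inverse (1 - z • A)) 0 := by
  have h1 : ContinuousAt (Ring.inverse : (S.X →L[ℂ] S.X) → _) (1 - (0 : ℂ) • A) := by
    simpa using NormedRing.inverse_continuousAt (1 : (S.X →L[ℂ] S.X)ˣ)
  exact ContinuousAt.comp (f := fun z : ℂ => 1 - z • A) h1 (by fun_prop)

/-- The coefficients of the transfer function at the origin are determined by its germ. -/
theorem IsRealization.markov_eq (hS : S.IsRealization θ) (hT : T.IsRealization θ) :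
    S.D = T.D ∧ ∀ n, S.C ∘L (S.A ^ n) ∘L S.B = T.C ∘L (T.A ^ n) ∘L T.B := by
  let F : (R : LinSystem.{w} U Y) → ℕ → ℂ → (U →L[ℂ] Y) := fun R n z =>
    R.C ∘L ((R.A ^ n * Ring.inverse (1 - z • R.A)) ∘L R.B)
  have hcont : ∀ R n, ContinuousAt (F R n) 0 := fun R n => by
    have := continuousAt_resolvent R.A
    refine ContinuousAt.clm_comp continuousAt_const (ContinuousAt.clm_comp ?_ continuousAt_const)
    exact continuousAt_const.mul this
  have hrec : ∀ R n, ∀ᶠ z in 𝓝 (0 : ℂ),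
      F R n z = R.C ∘L (R.A ^ n) ∘L R.B + z • F R (n + 1) z := fun R n => by
    filter_upwards [eventually_norm_smul_lt R.A] with z hz
    have h1 : (1 - z • R.A) * Ring.inverse (1 - z • R.A) = 1 :=
      Ring.mul_inverse_cancel _ (isUnit_one_sub hz)
    have h2 : Ring.inverse (1 - z • R.A) = 1 + z • (R.A * Ring.inverse (1 - z • R.A)) := by
      rw [sub_mul, one_mul, smul_mul_assoc] at h1
      exact sub_eq_iff_eq_add.mp h1
    simp only [F]
    rw [h2, mul_add, mul_one, mul_smul_comm, ← mul_assoc, ← pow_succ, ← h2]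
    simp
  have hzero : ∀ R n, F R n 0 = R.C ∘L (R.A ^ n) ∘L R.B := fun R n => by simp [F]
  have hD : S.D = T.D := by
    have h := (hS.and hT).self_of_nhds
    simpa [transfer] using h.1.trans h.2.symm
  have hF : ∀ n, F S n =ᶠ[𝓝 0] F T n := by
    intro n
    induction n with
    | zero =>
      refine eventuallyEq_of_smul (hcont S 0) (hcont T 0) ?_
      filter_upwards [hS, hT] with z h1 h2
      have h3 := h1.trans h2.symm
      rw [transfer, transfer, hD] at h3
      simpa [F] using add_left_cancel h3
    | succ n ih =>
      refine eventuallyEq_of_smul (hcont S _) (hcont T _) ?_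
      filter_upwards [ih, hrec S n, hrec T n] with z h1 h2 h3
      have h4 := ih.self_of_nhds
      rw [hzero, hzero] at h4
      rw [h2, h3, h4] at h1
      exact add_left_cancel h1
  refine ⟨hD, fun n => ?_⟩
  rw [← hzero, ← hzero]
  exact (hF n).self_of_nhds

end Realization

variable {U : Type u} [NormedAddCommGroup U] [InnerProductSpace ℂ U]
variable {Y : Type v} [NormedAddCommGroup Y] [InnerProductSpace ℂ Y]

/-! ### Systems and their adjoints -/

section OfOperator

variable {X : Type w} [NormedAddCommGroup X] [InnerProductSpace ℂ X] [CompleteSpace X]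
  [TopologicalSpace.SeparableSpace X] [PontryaginSpace X]

/-- The system whose system operator is a given operator between the direct sums. -/
noncomputable def ofOperator (M : WithLp 2 (X × U) →L[ℂ] WithLp 2 (X × Y)) :
    LinSystem.{w} U Y where
  X := X
  A := WithLp.fstL 2 ℂ X Y ∘L M ∘L prodInl X U
  B := WithLp.fstL 2 ℂ X Y ∘L M ∘L prodInr X U
  C := WithLp.sndL 2 ℂ X Y ∘L M ∘L prodInl X U
  D := WithLp.sndL 2 ℂ X Y ∘L M ∘L prodInr X U

theorem ofOperator_state (M : WithLp 2 (X × U) →L[ℂ] WithLp 2 (X × Y)) (x : X) (u : U) :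
    (ofOperator M).A x + (ofOperator M).B u = (M (WithLp.toLp 2 (x, u))).fst := by
  rw [toLp_eq_add, map_add]; rfl

theorem ofOperator_output (M : WithLp 2 (X × U) →L[ℂ] WithLp 2 (X × Y)) (x : X) (u : U) :
    (ofOperator M).C x + (ofOperator M).D u = (M (WithLp.toLp 2 (x, u))).snd := by
  rw [toLp_eq_add, map_add]; rfl

variable [PontryaginSpace U] [PontryaginSpace Y]

theorem ofOperator_isPassive {M : WithLp 2 (X × U) →L[ℂ] WithLp 2 (X × Y)}
    (hM : ∀ p, energy (M p) ≤ energy p) : (ofOperator M).IsPassive := by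
  rintro ⟨x, u⟩
  change X at x
  have h := hM (WithLp.toLp 2 (x, u))
  rw [energy_prod, energy_prod, ← ofOperator_state, ← ofOperator_output] at h
  exact h

end OfOperator

section Passive

variable [PontryaginSpace U] [PontryaginSpace Y]

theorem IsPassive.energy_le {S : LinSystem.{w} U Y} (hS : S.IsPassive) (x : S.X) (a : U) :
    energy (S.A x + S.B a) + energy (S.C x + S.D a) ≤ energy x + energy a := hS (x, a)

variable [CompleteSpace U] [CompleteSpace Y]

/-- The adjoint system `(A*, C*, B*, D*)`. -/
noncomputable def dual (S : LinSystem.{w} U Y) : LinSystem.{w} Y U where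
  X := S.X
  A := adj S.A
  B := adj S.C
  C := adj S.B
  D := adj S.D

theorem isObservable_iff_dual (S : LinSystem.{w} U Y) :
    S.IsObservable ↔ S.dual.IsControllable := Iff.rfl

theorem dual_dual (S : LinSystem.{w} U Y) : S.dual.dual = S := by
  cases S
  simp only [dual]
  congr 1 <;> exact adj_adj _

theorem dual_isPassive {S : LinSystem.{w} U Y} (hUY : negIndex U = negIndex Y)
    (hS : S.IsPassive) : S.dual.IsPassive := by
  let e := (WithLp.prodContinuousLinearEquiv 2 ℂ S.X Y).symm.toContinuousLinearMap
  let f := (WithLp.prodContinuousLinearEquiv 2 ℂ S.X U).toContinuousLinearMap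
  let M : WithLp 2 (S.X × U) →L[ℂ] WithLp 2 (S.X × Y) := e ∘L S.systemOperator ∘L f
  let e' := (WithLp.prodContinuousLinearEquiv 2 ℂ S.X U).symm.toContinuousLinearMap
  let f' := (WithLp.prodContinuousLinearEquiv 2 ℂ S.X Y).toContinuousLinearMap
  let N : WithLp 2 (S.X × Y) →L[ℂ] WithLp 2 (S.X × U) := e' ∘L S.dual.systemOperator ∘L f'
  have hM : ∀ p, M p = WithLp.toLp 2 (S.A p.fst + S.B p.snd, S.C p.fst + S.D p.snd) :=
    fun p => rfl
  have hN : ∀ q, N q = WithLp.toLp 2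
      (adj S.A q.fst + adj S.C q.snd, adj S.B q.fst + adj S.D q.snd) := fun p => rfl
  have hMN : adj M = N := adj_eq_of_form fun p q => by
    simp only [hM, hN, form_prod, WithLp.toLp_fst, WithLp.toLp_snd, form_add_left, form_add_right,
      form_adj]
    ring
  have hMc : ∀ p, energy (M p) ≤ energy p := fun p => by
    rw [energy_prod, energy_prod, hM]; exact hS.energy_le _ _
  rintro ⟨x, y⟩
  have := energy_adj_le (by rw [negIndex_prod, negIndex_prod, hUY]) hMc (WithLp.toLp 2 (x, y))
  rw [hMN, energy_prod, energy_prod, hN] at this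
  exact this

omit [PontryaginSpace U] [CompleteSpace U] in
/-- Observability in terms of `C Aⁿ`, without adjoints. -/
theorem isObservable_iff (S : LinSystem.{w} U Y) :
    S.IsObservable ↔ ∀ x, (∀ n, S.C ((S.A ^ n) x) = 0) → x = 0 := by
  have key : ∀ (n : ℕ) (x : S.X) (y : Y),
      form x (((adj S.A) ^ n) (adj S.C y)) = form (S.C ((S.A ^ n) x)) y := fun n x y => by
    rw [← adj_pow, ← form_adj, ← form_adj]
  rw [IsObservable, topologicalClosure_eq_top_iff]
  refine forall_congr' fun x => ?_
  refine imp_congr ⟨fun h n => ?_, fun h s hs => ?_⟩ Iff.rfl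
  · refine eq_zero_of_form fun y => ?_
    rw [← key]
    exact h _ (Submodule.mem_iSup_of_mem n ⟨y, rfl⟩)
  · induction hs using Submodule.iSup_induction' with
    | mem n s hs =>
      obtain ⟨y, rfl⟩ := hs
      refine (key n x y).trans ?_
      rw [h, form_zero_left]
    | zero => simp
    | add a b _ _ ha hb => rw [form_add_right, ha, hb, add_zero]

theorem dual_markov (S : LinSystem.{w} U Y) (n : ℕ) :
    S.dual.C ∘L (S.dual.A ^ n) ∘L S.dual.B = adj (S.C ∘L (S.A ^ n) ∘L S.B) := by
  rw [adj_comp, adj_comp, adj_pow]; rfl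

end Passive

/-! ### Comparison of controllable systems -/

section Intertwiner

variable {S T : LinSystem.{w} U Y}

/-- If `T` reaches states of smaller energy than the controllable system `S` for the same inputs,
then the states of `S` are mapped to those of `T` by a contraction. -/
theorem exists_intertwiner (hS : S.IsControllable) (hind : negIndex S.X = negIndex T.X)
    (hm : ∀ n, S.C ∘L (S.A ^ n) ∘L S.B = T.C ∘L (T.A ^ n) ∘L T.B)
    (hE : ∀ ξ, energy (T.reachMap ξ) ≤ energy (S.reachMap ξ)) :
    ∃ V : S.X →L[ℂ] T.X, (∀ ξ, V (S.reachMap ξ) = T.reachMap ξ) ∧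
      (∀ x, V (S.A x) = T.A (V x)) ∧ (∀ a, V (S.B a) = T.B a) ∧ (∀ x, S.C x = T.C (V x)) := by
  have hd := S.isControllable_iff.mp hS
  obtain ⟨V, hV⟩ := exists_extension hind rfl hd hE
  refine ⟨V, hV, fun x => ?_, fun a => ?_, fun x => ?_⟩
  · refine hd.induction_on (p := fun x => V (S.A x) = T.A (V x)) x
      (isClosed_eq (by fun_prop) (by fun_prop)) fun ξ => ?_
    rw [hV, ← reachMap_delay, ← reachMap_delay, hV]
  · have := hV (Finsupp.single 0 a)
    rwa [reachMap_single, reachMap_single] at this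
  · refine hd.induction_on (p := fun x => S.C x = T.C (V x)) x
      (isClosed_eq (by fun_prop) (by fun_prop)) fun ξ => ?_
    rw [hV]
    induction ξ using Finsupp.induction_linear with
    | zero => simp
    | add f g hf hg => simp only [map_add, hf, hg]
    | single n a =>
      rw [reachMap_single, reachMap_single]
      exact congrArg (fun M : U →L[ℂ] Y => M a) (hm n)

theorem energy_eq_of_dense {V : S.X →L[ℂ] T.X} (hS : S.IsControllable)
    (hV : ∀ ξ, V (S.reachMap ξ) = T.reachMap ξ)
    (hE : ∀ ξ, energy (T.reachMap ξ) = energy (S.reachMap ξ)) (x : S.X) :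
    energy (V x) = energy x :=
  (S.isControllable_iff.mp hS).induction_on (p := fun x => energy (V x) = energy x) x
    (isClosed_eq (continuous_energy.comp V.continuous) continuous_energy)
    fun ξ => by rw [hV, hE]

/-- The intertwiners in the two directions are inverse to each other on the reachable states. -/
theorem unitarilySimilar_of_energy_eq (hS : S.IsControllable) (hT : T.IsControllable)
    (hind : negIndex S.X = negIndex T.X) (hD : S.D = T.D)
    (hm : ∀ n, S.C ∘L (S.A ^ n) ∘L S.B = T.C ∘L (T.A ^ n) ∘L T.B)
    (hE : ∀ ξ, energy (T.reachMap ξ) = energy (S.reachMap ξ)) : S.UnitarilySimilar T := by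
  obtain ⟨V, hV, hVA, hVB, hVC⟩ := exists_intertwiner hS hind hm fun ξ => (hE ξ).le
  obtain ⟨W, hW, -⟩ := exists_intertwiner hT hind.symm (fun n => (hm n).symm) fun ξ => (hE ξ).ge
  have hWV : ∀ x, W (V x) = x := fun x =>
    (S.isControllable_iff.mp hS).induction_on (p := fun x => W (V x) = x) x
      (isClosed_eq (by fun_prop) continuous_id) fun ξ => by rw [hV, hW]
  have hVW : ∀ x, V (W x) = x := fun x =>
    (T.isControllable_iff.mp hT).induction_on (p := fun x => V (W x) = x) x
      (isClosed_eq (by fun_prop) continuous_id) fun ξ => by rw [hW, hV]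
  let e : S.X ≃L[ℂ] T.X := ContinuousLinearEquiv.equivOfInverse V W hWV hVW
  refine ⟨hD, e, form_eq_of_energy (V := V) (energy_eq_of_dense hS hV hE), fun x => ?_, fun a => ?_,
    hVC⟩
  · exact (e.symm_apply_eq.mpr (hVA x).symm).symm
  · exact (e.symm_apply_eq.mpr (hVB a).symm).symm

theorem UnitarilySimilar.energy_reachMap (h : S.UnitarilySimilar T) (ξ : ℕ →₀ U) :
    energy (T.reachMap ξ) = energy (S.reachMap ξ) := by
  obtain ⟨-, V, hf, hA, hB, -⟩ := h
  have hV : T.reachMap ξ = V (S.reachMap ξ) := by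
    have hn : ∀ (n : ℕ) (x : S.X), V ((S.A ^ n) x) = (T.A ^ n) (V x) := by
      intro n
      induction n with
      | zero => intro x; rfl
      | succ n ih =>
        intro x
        rw [pow_succ, pow_succ]
        change V ((S.A ^ n) (S.A x)) = (T.A ^ n) (T.A (V x))
        rw [ih, hA, V.apply_symm_apply]
    induction ξ using Finsupp.induction_linear with
    | zero => simp
    | add f g hf hg => simp only [map_add, hf, hg]
    | single n a => rw [reachMap_single, reachMap_single, hn, hB, V.apply_symm_apply]
  rw [hV, energy, hf]; rfl

theorem forall_energy_reach_le_iff :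
    (∀ n a, energy (S.reach n a) ≤ energy (T.reach n a)) ↔
      ∀ ξ, energy (S.reachMap ξ) ≤ energy (T.reachMap ξ) := by
  constructor
  · intro h ξ
    rw [reachMap_eq_reach, reachMap_eq_reach]; exact h _ _
  · intro h n a
    rw [← reachMap_sum_single, ← reachMap_sum_single]; exact h _

end Intertwiner

/-! ### The controllable part of a passive system -/

section Compression

variable [PontryaginSpace U] [PontryaginSpace Y] [TopologicalSpace.SeparableSpace U]
  [CompleteSpace Y]

/-- The controllable part of a passive system, as a passive system on the Pontryagin space completion
of the space of input sequences with the form of the states they reach. That form may be degenerate,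
so that the state space need not be a subspace of the original one. -/
theorem exists_controllable {S : LinSystem.{w} U Y} (hS : S.IsPassive)
    (hUY : negIndex U = negIndex Y) :
    ∃ T : LinSystem.{w} U Y, T.IsPassive ∧ T.IsControllable ∧ T.D = S.D ∧
      (∀ n, T.C ∘L (T.A ^ n) ∘L T.B = S.C ∘L (S.A ^ n) ∘L S.B) ∧
      negIndex T.X ≤ negIndex S.X ∧
      ∀ ξ, energy (T.reachMap ξ) = energy (S.reachMap ξ) := by
  have hsmall : Small.{w} U := small_of_separable U
  let h := pullback (formₗ S.X) S.reachMap
  have hq : ∀ ξ, quad h ξ = energy (S.reachMap ξ) := fun ξ => rfl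
  have hmax : ¬HasNeg (quad h) (negIndex S.X + 1) := fun hn => by
    have := hasNeg_iff.mp (hn.map S.reachMap fun ξ => (hq ξ).ge)
    omega
  obtain ⟨k, hk, h1, h2⟩ := exists_maximal_hasNeg hmax
  obtain ⟨P, _, _, _, _, j, hj, hf, hP⟩ :=
    exists_completion_of_small.{w} (h := h) (fun x y => form_conj _ _) h1 h2
  have hje : ∀ ξ, energy (j ξ) = energy (S.reachMap ξ) := fun ξ => congrArg Complex.re (hf ξ ξ)
  -- the action of the system on the states reached by input sequences
  let ι : ((ℕ →₀ U) × U) →ₗ[ℂ] WithLp 2 (P × U) :=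
    (WithLp.linearEquiv 2 ℂ (P × U)).symm.toLinearMap ∘ₗ j.prodMap LinearMap.id
  let M₀ : ((ℕ →₀ U) × U) →ₗ[ℂ] WithLp 2 (P × Y) :=
    (WithLp.linearEquiv 2 ℂ (P × Y)).symm.toLinearMap ∘ₗ
      (j ∘ₗ (delay U).coprod (Finsupp.lsingle 0)).prod
        ((S.C.toLinearMap ∘ₗ S.reachMap).coprod S.D.toLinearMap)
  have hι₀ : ∀ ξ a, ι (ξ, a) = WithLp.toLp 2 (j ξ, a) := fun ξ a => rfl
  have hM₀ : ∀ ξ a, M₀ (ξ, a) = WithLp.toLp 2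
      (j (delay U ξ + Finsupp.single 0 a), S.C (S.reachMap ξ) + S.D a) := fun ξ a => rfl
  have hι : DenseRange ι := by
    have := (WithLp.prodContinuousLinearEquiv 2 ℂ P U).symm.surjective.denseRange.comp
      (hj.prodMap (Function.surjective_id (α := U)).denseRange)
      (WithLp.prodContinuousLinearEquiv 2 ℂ P U).symm.continuous
    exact this
  have hcontr : ∀ p, energy (M₀ p) ≤ energy (ι p) := by
    rintro ⟨ξ, a⟩
    rw [hM₀, hι₀, energy_prod, energy_prod]
    simp only [WithLp.toLp_fst, WithLp.toLp_snd]
    rw [hje, hje, map_add, reachMap_delay, reachMap_single]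
    exact hS.energy_le _ _
  obtain ⟨M, hM⟩ := exists_extension (negIndex_prod (X := P) (Y := U))
    (by rw [negIndex_prod, hUY]) hι hcontr
  -- the state blocks of `M`, which are needed before `P` is known to be separable
  let A : P →L[ℂ] P := WithLp.fstL 2 ℂ P Y ∘L M ∘L prodInl P U
  let B : U →L[ℂ] P := WithLp.fstL 2 ℂ P Y ∘L M ∘L prodInr P U
  have hA : ∀ ξ, A (j ξ) = j (delay U ξ) := fun ξ => by
    change (M (WithLp.toLp 2 (j ξ, 0))).fst = _
    rw [← hι₀, hM, hM₀]
    simp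
  have hB : ∀ a, B a = j (Finsupp.single 0 a) := fun a => by
    have h3 : ι (0, a) = WithLp.toLp 2 (0, a) := by rw [hι₀, map_zero]
    change (M (WithLp.toLp 2 (0, a))).fst = _
    rw [← h3, hM, hM₀]
    simp
  have hAB : ∀ n a, (A ^ n) (B a) = j (Finsupp.single n a) := by
    intro n a
    induction n with
    | zero => exact hB a
    | succ n ih =>
      rw [pow_succ']
      change A ((A ^ n) (B a)) = _
      rw [ih, hA, delay_single]
  have hsep : TopologicalSpace.SeparableSpace P := separableSpace_of_denseRange hj fun n => by
    simp only [← hAB]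
    exact ((A ^ n) ∘L B).continuous
  have hreach : (ofOperator M).reachMap = j := by
    refine Finsupp.lhom_ext fun n a => ?_
    rw [reachMap_single]
    exact hAB n a
  have hC : ∀ ξ, (ofOperator M).C (j ξ) = S.C (S.reachMap ξ) := fun ξ => by
    change (M (WithLp.toLp 2 (j ξ, 0))).snd = _
    rw [← hι₀, hM, hM₀]
    simp
  refine ⟨ofOperator M, ofOperator_isPassive (energy_le_of_dense hι fun p => ?_), ?_, ?_, fun n => ?_,
    ?_, fun ξ => ?_⟩
  · rw [hM]; exact hcontr p
  · rw [isControllable_iff, hreach]; exact hj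
  · ext a
    have h3 : ι (0, a) = WithLp.toLp 2 (0, a) := by rw [hι₀, map_zero]
    change (M (WithLp.toLp 2 (0, a))).snd = _
    rw [← h3, hM, hM₀]
    simp
  · ext a
    change (ofOperator M).C ((A ^ n) (B a)) = S.C ((S.A ^ n) (S.B a))
    rw [hAB, hC, reachMap_single]
  · exact hP.le.trans hk
  · rw [hreach]; exact hje ξ

end Compression

end LinSystem

/-! ### Negative eigenvalues of Hermitian matrices -/

section Matrix

variable {n : ℕ} {G : Matrix (Fin n) (Fin n) ℂ}

/-- The Hermitian form of a matrix in an orthonormal basis of eigenvectors. -/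
theorem re_dotProduct_mulVec_eq_sum (hG : G.IsHermitian) (c : Fin n → ℂ) :
    (star c ⬝ᵥ G.mulVec c).re =
      ∑ i, hG.eigenvalues i * ‖inner ℂ (hG.eigenvectorBasis i) (WithLp.toLp 2 c)‖ ^ 2 := by
  set x : EuclideanSpace ℂ (Fin n) := WithLp.toLp 2 c
  have h1 : star c ⬝ᵥ G.mulVec c = inner ℂ x (WithLp.toLp 2 (G.mulVec c)) := by
    rw [EuclideanSpace.inner_eq_star_dotProduct, dotProduct_comm]
  have h2 : ∀ i, inner ℂ (hG.eigenvectorBasis i) (WithLp.toLp 2 (G.mulVec c))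
      = (hG.eigenvalues i : ℂ) * inner ℂ (hG.eigenvectorBasis i) x := by
    intro i
    rw [EuclideanSpace.inner_eq_star_dotProduct, EuclideanSpace.inner_eq_star_dotProduct]
    have h3 := hG.mulVec_eigenvectorBasis i
    have h4 : Matrix.vecMul (star (⇑(hG.eigenvectorBasis i))) G
        = (hG.eigenvalues i : ℂ) • star (⇑(hG.eigenvectorBasis i)) := by
      have := congrArg star h3
      rw [Matrix.star_mulVec, hG.eq] at this
      rw [this]
      ext j
      simp
    rw [dotProduct_comm, Matrix.dotProduct_mulVec, h4, smul_dotProduct, dotProduct_comm]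
    rfl
  rw [h1, ← hG.eigenvectorBasis.sum_inner_mul_inner, Complex.re_sum]
  refine Finset.sum_congr rfl fun i _ => ?_
  rw [h2, mul_left_comm, ← inner_conj_symm x, ← Complex.normSq_eq_conj_mul_self,
    Complex.normSq_eq_norm_sq, ← Complex.ofReal_mul, Complex.ofReal_re]

/-- The number of negative eigenvalues is the largest dimension of a negative subspace. -/
theorem hasNeg_matrix_iff (hG : G.IsHermitian) {k : ℕ} :
    HasNeg (fun c : Fin n → ℂ => (star c ⬝ᵥ G.mulVec c).re) k ↔
      k ≤ Nat.card {i : Fin n // hG.eigenvalues i < 0} := by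
  rw [Nat.card_eq_fintype_card]
  constructor
  · rintro ⟨φ, hφ⟩
    let ψ : (Fin n → ℂ) →ₗ[ℂ] ({i : Fin n // hG.eigenvalues i < 0} → ℂ) :=
      LinearMap.pi fun i => (innerₛₗ ℂ (hG.eigenvectorBasis i.1)) ∘ₗ
        (WithLp.linearEquiv 2 ℂ (Fin n → ℂ)).symm.toLinearMap
    have hinj : Function.Injective (ψ ∘ₗ φ) := by
      rw [injective_iff_map_eq_zero]
      intro c hc
      by_contra h0
      have h1 := hφ c h0
      beta_reduce at h1
      rw [re_dotProduct_mulVec_eq_sum hG] at h1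
      refine absurd h1 (not_lt.mpr (Finset.sum_nonneg fun i _ => ?_))
      by_cases hi : hG.eigenvalues i < 0
      · have h2 : inner ℂ (hG.eigenvectorBasis i) (WithLp.toLp 2 (φ c)) = (0 : ℂ) :=
          congrFun hc ⟨i, hi⟩
        rw [h2]; simp
      · have := not_lt.mp hi
        positivity
    have := LinearMap.finrank_le_finrank_of_injective hinj
    rwa [Module.finrank_fin_fun, Module.finrank_fintype_fun_eq_card] at this
  · intro hk
    refine HasNeg.mono ?_ hk
    rw [← Module.finrank_fintype_fun_eq_card ℂ]
    let ψ : ({i : Fin n // hG.eigenvalues i < 0} → ℂ) →ₗ[ℂ] (Fin n → ℂ) :=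
      (WithLp.linearEquiv 2 ℂ (Fin n → ℂ)).toLinearMap ∘ₗ
        Fintype.linearCombination ℂ fun i => hG.eigenvectorBasis i.1
    refine hasNeg_of_linearMap ψ fun c hc => ?_
    rw [re_dotProduct_mulVec_eq_sum hG]
    have h1 : ∀ i, inner ℂ (hG.eigenvectorBasis i) (WithLp.toLp 2 (ψ c))
        = if h : hG.eigenvalues i < 0 then c ⟨i, h⟩ else 0 := by
      intro i
      have h2 : WithLp.toLp 2 (ψ c) = ∑ j, c j • hG.eigenvectorBasis j.1 := rfl
      rw [h2, inner_sum]
      simp only [inner_smul_right, orthonormal_iff_ite.mp hG.eigenvectorBasis.orthonormal]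
      split_ifs with hi
      · rw [Finset.sum_eq_single ⟨i, hi⟩]
        · simp
        · intro b _ hb
          rw [if_neg fun h => hb (Subtype.ext h.symm), mul_zero]
        · simp
      · refine Finset.sum_eq_zero fun b _ => ?_
        have hib : i ≠ b.1 := fun h => hi (h ▸ b.2)
        rw [if_neg hib, mul_zero]
    obtain ⟨j, hj⟩ := Function.ne_iff.mp hc
    refine Finset.sum_neg' (fun i _ => ?_) ⟨j.1, Finset.mem_univ _, ?_⟩
    · rw [h1]
      split_ifs with hi
      · exact mul_nonpos_of_nonpos_of_nonneg hi.le (by positivity)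
      · simp
    · rw [h1, dif_pos j.2]
      have : 0 < ‖c j‖ := norm_pos_iff.mpr hj
      exact mul_neg_of_neg_of_pos j.2 (by positivity)

end Matrix

/-! ### The Hermitian form of the Schur kernel -/

section KernelForm

variable {Y : Type v} [NormedAddCommGroup Y] [InnerProductSpace ℂ Y] [PontryaginSpace Y]
variable {ι : Type*}

/-- The sesquilinear form of an operator-valued kernel `k` on the finitely supported `Y`-valued
functions. -/
noncomputable def kernelForm (k : ι → ι → Y →L[ℂ] Y) : (ι →₀ Y) →ₗ[ℂ] (ι →₀ Y) →ₗ⋆[ℂ] ℂ :=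
  LinearMap.mk₂'ₛₗ (RingHom.id ℂ) (starRingEnd ℂ)
    (fun a b => a.sum fun w f => b.sum fun z g => form (k w z f) g)
    (fun a a' b => by
      refine Finsupp.sum_add_index' (by simp) fun w f f' => ?_
      simp only [map_add, form_add_left, Finsupp.sum_add])
    (fun c a b => by
      rw [Finsupp.sum_smul_index' (by simp)]
      simp only [map_smul, form_smul_left, smul_eq_mul, RingHom.id_apply]
      simp only [Finsupp.sum, Finset.mul_sum])
    (fun a b b' => by
      rw [← Finsupp.sum_add]
      refine Finsupp.sum_congr fun w _ => ?_
      exact Finsupp.sum_add_index' (by simp) fun z g g' => form_add_right _ _ _)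
    (fun c a b => by
      simp only [Finsupp.sum, smul_eq_mul, Finset.mul_sum]
      refine Finset.sum_congr rfl fun w _ => ?_
      have := Finsupp.sum_smul_index' (g := b) (b := c) (h := fun z g => form (k w z (a w)) g)
        (by simp)
      simp only [Finsupp.sum] at this
      rw [this]
      exact Finset.sum_congr rfl fun z _ => form_smul_right _ _ _)

@[simp] theorem kernelForm_single (k : ι → ι → Y →L[ℂ] Y) (w z : ι) (f g : Y) :
    kernelForm k (Finsupp.single w f) (Finsupp.single z g) = form (k w z f) g := by
  change ((Finsupp.single w f).sum fun w f => (Finsupp.single z g).sum fun z g =>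
    form (k w z f) g) = _
  rw [Finsupp.sum_single_index (by simp)]
  exact Finsupp.sum_single_index (by simp)

theorem kernelForm_symm {k : ι → ι → Y →L[ℂ] Y}
    (hk : ∀ w z f g, conj (form (k w z f) g) = form (k z w g) f) (a b : ι →₀ Y) :
    conj (kernelForm k a b) = kernelForm k b a := by
  induction a using Finsupp.induction_linear with
  | zero => simp
  | add a a' ha ha' => simp only [map_add, LinearMap.add_apply, ha, ha']
  | single w f =>
    induction b using Finsupp.induction_linear with
    | zero => simp
    | add b b' hb hb' => simp only [map_add, LinearMap.add_apply, hb, hb']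
    | single z g => rw [kernelForm_single, kernelForm_single, hk]

end KernelForm

section NegativeSquares

variable {U : Type u} [NormedAddCommGroup U] [InnerProductSpace ℂ U] [CompleteSpace U]
  [PontryaginSpace U]
variable {Y : Type v} [NormedAddCommGroup Y] [InnerProductSpace ℂ Y] [CompleteSpace Y]
  [PontryaginSpace Y]
variable {θ : ℂ → (U →L[ℂ] Y)} {Ω : Set ℂ} {κ : ℕ}

/-- The Schur kernel restricted to a set. -/
noncomputable def schurForm (θ : ℂ → (U →L[ℂ] Y)) (Ω : Set ℂ) :
    (Ω →₀ Y) →ₗ[ℂ] (Ω →₀ Y) →ₗ⋆[ℂ] ℂ :=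
  kernelForm fun w z => schurKernel θ w z

theorem schurKernel_symm (w z : ℂ) (f g : Y) :
    conj (form (schurKernel θ w z f) g) = form (schurKernel θ z w g) f := by
  simp only [form_schurKernel, map_mul, map_sub, map_inv₀, form_conj, map_one, Complex.conj_conj]
  rw [mul_comm w]

theorem schurForm_symm (a b : Ω →₀ Y) : conj (schurForm θ Ω a b) = schurForm θ Ω b a :=
  kernelForm_symm (k := fun w z : Ω => schurKernel θ w z)
    (fun w z f g => schurKernel_symm (w : ℂ) z f g) a b

theorem quad_schurForm_linearCombination {n : ℕ} (w : Fin n → Ω) (f : Fin n → Y)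
    (c : Fin n → ℂ) :
    quad (schurForm θ Ω) (Fintype.linearCombination ℂ (fun i => Finsupp.single (w i) (f i)) c) =
      (star c ⬝ᵥ (kernelMatrix θ (fun i => (w i : ℂ)) f).mulVec c).re := by
  rw [quad, Fintype.linearCombination_apply]
  congr 1
  simp only [map_sum, map_smul, LinearMap.sum_apply, LinearMap.smul_apply, LinearMap.map_smulₛₗ,
    schurForm, kernelForm_single, dotProduct, Matrix.mulVec, kernelMatrix, Matrix.of_apply,
    Finset.mul_sum, smul_eq_mul, Pi.star_apply]
  refine Finset.sum_congr rfl fun i _ => Finset.sum_congr rfl fun j _ => ?_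
  rw [← starRingEnd_apply]
  ring

theorem HasNegativeSquares.hasNeg (h : HasNegativeSquares κ θ Ω) :
    HasNeg (quad (schurForm θ Ω)) κ := by
  obtain ⟨n, w, f, hw, hκ⟩ := h.2
  have h1 := (hasNeg_matrix_iff (kernelMatrix_isHermitian θ w f)).mpr hκ.ge
  exact h1.map (Fintype.linearCombination ℂ
    (fun i => Finsupp.single (⟨w i, hw i⟩ : Ω) (f i))) fun c =>
      (quad_schurForm_linearCombination (fun i => (⟨w i, hw i⟩ : Ω)) f c).le

/-- A negative subspace of finitely supported functions of dimension `κ + 1` would involve finitely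
many points and vectors, and their matrix would have `κ + 1` negative eigenvalues. -/
theorem HasNegativeSquares.not_hasNeg (h : HasNegativeSquares κ θ Ω) :
    ¬HasNeg (quad (schurForm θ Ω)) (κ + 1) := by
  classical
  rintro ⟨φ, hφ⟩
  -- all values of the functions spanning the negative subspace, as one finite family
  let s : Finset Ω := Finset.univ.biUnion fun i => (φ (Pi.single i 1)).support
  let e := (Fintype.equivFin (Fin (κ + 1) × s)).symm
  let w : Fin (Fintype.card (Fin (κ + 1) × s)) → Ω := fun t => (e t).2.1
  let f : Fin (Fintype.card (Fin (κ + 1) × s)) → Y := fun t => φ (Pi.single (e t).1 1) (e t).2.1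
  have hsum : ∀ c, φ c =
      Fintype.linearCombination ℂ (fun t => Finsupp.single (w t) (f t)) fun t => c (e t).1 := by
    intro c
    have hd : c = ∑ i, c i • (Pi.single i 1 : Fin (κ + 1) → ℂ) := by
      ext j; simp [Finset.sum_apply, Pi.single_apply]
    have hs : ∀ i, φ (Pi.single i 1) = ∑ z : s, Finsupp.single z.1 (φ (Pi.single i 1) z.1) := by
      intro i
      have h1 := Finsupp.sum_single (φ (Pi.single i 1))
      rw [Finsupp.sum_of_support_subset (s := s) _
        (Finset.subset_biUnion_of_mem (fun i => (φ (Pi.single i 1)).support) (Finset.mem_univ i))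
        _ (by simp)] at h1
      rw [Finset.sum_coe_sort s fun z => Finsupp.single z (φ (Pi.single i 1) z)]
      exact h1.symm
    rw [Fintype.linearCombination_apply,
      e.sum_comp fun p => c p.1 • Finsupp.single p.2.1 (φ (Pi.single p.1 1) p.2.1),
      Fintype.sum_prod_type]
    conv_lhs => rw [hd, map_sum]
    refine Finset.sum_congr rfl fun i _ => ?_
    rw [map_smul]
    conv_lhs => rw [hs i]
    exact Finset.smul_sum
  have h1 : HasNeg (fun c => (star c ⬝ᵥ (kernelMatrix θ (fun i => (w i : ℂ)) f).mulVec c).re)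
      (κ + 1) := by
    refine ⟨LinearMap.funLeft ℂ ℂ fun t => (e t).1, fun c hc => ?_⟩
    beta_reduce
    rw [← quad_schurForm_linearCombination]
    have := hφ c hc
    rw [hsum] at this
    exact this
  have h2 := (hasNeg_matrix_iff (kernelMatrix_isHermitian θ _ f)).mp h1
  have h3 := h.1 _ (fun i => (w i : ℂ)) f fun i => (w i).2
  rw [negEigenvalueCount] at h3
  omega

/-- A Pontryagin space with vectors `kv w f` reproducing the Schur kernel on `Ω`. -/
structure IsKernelSpace {P : Type w} [NormedAddCommGroup P] [InnerProductSpace ℂ P]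
    [PontryaginSpace P] (θ : ℂ → (U →L[ℂ] Y)) (Ω : Set ℂ) (kv : Ω → Y →ₗ[ℂ] P) : Prop where
  form_kv : ∀ w z f g, form (kv w f) (kv z g) = form (schurKernel θ w z f) g
  dense : DenseRange (Finsupp.lsum ℂ kv)

theorem HasNegativeSquares.exists_kernelSpace [TopologicalSpace.SeparableSpace Y]
    (h : HasNegativeSquares κ θ Ω) :
    ∃ (P : Type w) (_ : NormedAddCommGroup P) (_ : InnerProductSpace ℂ P) (_ : CompleteSpace P)
      (_ : PontryaginSpace P) (kv : Ω → Y →ₗ[ℂ] P), IsKernelSpace θ Ω kv ∧ negIndex P = κ := by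
  have : Small.{w} Y := small_of_separable Y
  obtain ⟨P, i1, i2, i3, i4, j, hj, hf, hP⟩ :=
    exists_completion_of_small.{w} (h := schurForm θ Ω) schurForm_symm h.hasNeg h.not_hasNeg
  have hsum : Finsupp.lsum ℂ (fun w : Ω => j ∘ₗ Finsupp.lsingle w) = j :=
    Finsupp.lhom_ext fun w f => by simp
  refine ⟨P, i1, i2, i3, i4, fun w => j ∘ₗ Finsupp.lsingle w, ⟨fun w z f g => ?_, ?_⟩, hP⟩
  · exact (hf _ _).trans (kernelForm_single _ _ _ _ _)
  · rw [hsum]; exact hj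

end NegativeSquares

/-! ### Analytic dependence of the kernel vectors -/

section Kernel

variable {U : Type u} [NormedAddCommGroup U] [InnerProductSpace ℂ U] [CompleteSpace U]
  [PontryaginSpace U]
variable {Y : Type v} [NormedAddCommGroup Y] [InnerProductSpace ℂ Y] [CompleteSpace Y]
  [PontryaginSpace Y]
variable {θ : ℂ → (U →L[ℂ] Y)} {Ω : Set ℂ}
variable {P : Type w} [NormedAddCommGroup P] [InnerProductSpace ℂ P] [CompleteSpace P]
  [PontryaginSpace P] {kv : Ω → Y →ₗ[ℂ] P}

open Classical in
/-- The kernel vectors, extended by zero to the whole plane. -/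
noncomputable def extendKv (kv : Ω → Y →ₗ[ℂ] P) (f : Y) (z : ℂ) : P :=
  if h : z ∈ Ω then kv ⟨z, h⟩ f else 0

omit [CompleteSpace Y] [PontryaginSpace Y] [CompleteSpace P] [PontryaginSpace P] in
theorem extendKv_of_mem (f : Y) {z : ℂ} (hz : z ∈ Ω) : extendKv kv f z = kv ⟨z, hz⟩ f :=
  dif_pos hz

theorem one_sub_mul_conj_ne_zero (hΩ : Ω ⊆ Metric.ball 0 1) {w z : ℂ} (hw : w ∈ Ω) (hz : z ∈ Ω) :
    1 - z * conj w ≠ 0 := by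
  have h1 : ‖w‖ < 1 := by simpa using hΩ hw
  have h2 : ‖z‖ < 1 := by simpa using hΩ hz
  intro h
  have h3 : ‖z * conj w‖ = 1 := by rw [← sub_eq_zero.mp h]; simp
  rw [norm_mul, RCLike.norm_conj] at h3
  nlinarith [norm_nonneg w, norm_nonneg z]

omit [CompleteSpace P] in
theorem IsKernelSpace.differentiableOn_of_mem_range (hk : IsKernelSpace θ Ω kv)
    (hΩ : Ω ⊆ Metric.ball 0 1) (hθ : DifferentiableOn ℂ θ Ω) (f : Y) (a : Ω →₀ Y) :
    DifferentiableOn ℂ (fun z => form (Finsupp.lsum ℂ kv a) (extendKv kv f z)) Ω := by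
  induction a using Finsupp.induction_linear with
  | zero => simp
  | add a b ha hb =>
    simp only [map_add, form_add_left]
    exact ha.add hb
  | single w g =>
    simp only [Finsupp.lsum_single]
    have h1 : DifferentiableOn ℂ (fun z => (1 - z * conj (w : ℂ))⁻¹ *
        (form g f - form (θ z (adj (θ w) g)) f)) Ω := by
      have h2 : DifferentiableOn ℂ (fun z => form (θ z (adj (θ w) g)) f) Ω := by
        let F : (U →L[ℂ] Y) →L[ℂ] ℂ := (innerSL ℂ f) ∘L J ∘L
          (ContinuousLinearMap.apply ℂ Y (adj (θ w) g))
        exact F.differentiable.comp_differentiableOn hθ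
      refine DifferentiableOn.mul (DifferentiableOn.inv (by fun_prop) fun z hz => ?_) ?_
      · exact one_sub_mul_conj_ne_zero hΩ w.2 hz
      · exact (differentiableOn_const _).sub h2
    refine h1.congr fun z hz => ?_
    rw [extendKv_of_mem f hz, hk.form_kv, form_schurKernel, ← form_adj (θ z)]

omit [CompleteSpace P] in
/-- The kernel vectors are locally bounded: their energies and their products with a maximal
negative subspace spanned by kernel vectors are continuous. -/
theorem IsKernelSpace.locally_bounded (hk : IsKernelSpace θ Ω kv)
    (hΩ : Ω ⊆ Metric.ball 0 1) (hθ : DifferentiableOn ℂ θ Ω) (f : Y) {z₀ : ℂ} (hz₀ : z₀ ∈ Ω) :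
    ∃ M > 0, ∀ᶠ z in 𝓝[Ω] z₀, ‖extendKv kv f z‖ ≤ M := by
  obtain ⟨φ, hφ⟩ := HasNeg.of_denseRange hk.dense (hasNeg_iff.mpr (le_refl (negIndex P)))
  obtain ⟨C, hC, hbound⟩ := exists_norm_sq_le (X := P) rfl (φ := Finsupp.lsum ℂ kv ∘ₗ φ) hφ
  have h1 : ContinuousOn (fun z => energy (extendKv kv f z)) Ω := by
    have h2 : ContinuousOn (fun z => ((1 - z * conj z)⁻¹ *
        (form f f - form (adj (θ z) f) (adj (θ z) f))).re) Ω := by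
      have h3 : ContinuousOn (fun z => adj (θ z) f) Ω := by
        have := continuous_adj.comp_continuousOn hθ.continuousOn
        exact this.clm_apply continuousOn_const
      have h4 : ContinuousOn (fun z => form (adj (θ z) f) (adj (θ z) f)) Ω :=
        continuous_form.comp_continuousOn (h3.prodMk h3)
      refine Complex.continuous_re.comp_continuousOn (ContinuousOn.mul (ContinuousOn.inv₀ ?_ ?_) ?_)
      · exact (continuous_const.sub (continuous_id.mul Complex.continuous_conj)).continuousOn
      · exact fun z hz => one_sub_mul_conj_ne_zero hΩ hz hz
      · exact continuousOn_const.sub h4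
    refine h2.congr fun z hz => ?_
    beta_reduce
    rw [extendKv_of_mem f hz, energy, hk.form_kv, form_schurKernel]
  have h2 : ContinuousOn (fun z => gram (formₗ P) (Finsupp.lsum ℂ kv ∘ₗ φ) (extendKv kv f z)) Ω := by
    refine continuousOn_pi.mpr fun i => ?_
    have := (hk.differentiableOn_of_mem_range hΩ hθ f (φ (Pi.single i 1))).continuousOn
    refine (Complex.continuous_conj.comp_continuousOn this).congr fun z _ => ?_
    exact (form_conj _ _).symm
  have h3 : ContinuousOn (fun z => C * (|energy (extendKv kv f z)| +
      ‖gram (formₗ P) (Finsupp.lsum ℂ kv ∘ₗ φ) (extendKv kv f z)‖ ^ 2)) Ω :=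
    continuousOn_const.mul (h1.abs.add (h2.norm.pow 2))
  set b := fun z => C * (|energy (extendKv kv f z)| +
      ‖gram (formₗ P) (Finsupp.lsum ℂ kv ∘ₗ φ) (extendKv kv f z)‖ ^ 2) with hb
  have h4 : ∀ᶠ z in 𝓝[Ω] z₀, b z < b z₀ + 1 :=
    (h3 z₀ hz₀).eventually_lt_const (lt_add_one _)
  have hb0 : 0 ≤ b z₀ := by positivity
  refine ⟨√(b z₀ + 1), by positivity, h4.mono fun z hz => ?_⟩
  exact Real.le_sqrt_of_sq_le ((hbound _).trans hz.le)

omit [CompleteSpace P] in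
theorem IsKernelSpace.differentiableOn (hk : IsKernelSpace θ Ω kv) (hopen : IsOpen Ω)
    (hΩ : Ω ⊆ Metric.ball 0 1) (hθ : DifferentiableOn ℂ θ Ω) (f : Y) (y : P) :
    DifferentiableOn ℂ (fun z => form y (extendKv kv f z)) Ω := by
  obtain ⟨a, ha⟩ : ∃ a : ℕ → (Ω →₀ Y), Filter.Tendsto (fun n => Finsupp.lsum ℂ kv (a n))
      Filter.atTop (𝓝 y) := by
    obtain ⟨x, hx, hlim⟩ := mem_closure_iff_seq_limit.mp (hk.dense y)
    choose a ha using hx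
    exact ⟨a, by simpa only [ha] using hlim⟩
  refine TendstoLocallyUniformlyOn.differentiableOn (φ := Filter.atTop)
    (F := fun n z => form (Finsupp.lsum ℂ kv (a n)) (extendKv kv f z)) ?_
    (Filter.Eventually.of_forall fun n => hk.differentiableOn_of_mem_range hΩ hθ f (a n)) hopen
  rw [Metric.tendstoLocallyUniformlyOn_iff]
  intro ε hε z₀ hz₀
  obtain ⟨M, hM, hb⟩ := hk.locally_bounded hΩ hθ f hz₀
  refine ⟨_, hb, ?_⟩
  have h1 : ∀ᶠ n in Filter.atTop, dist (Finsupp.lsum ℂ kv (a n)) y < ε / M :=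
    Metric.tendsto_nhds.mp ha _ (by positivity)
  filter_upwards [h1] with n hn z hz
  rw [dist_eq_norm, ← form_sub_left]
  refine (norm_form_le _ _).trans_lt ?_
  rw [dist_comm, dist_eq_norm, lt_div_iff₀ hM] at hn
  exact (mul_le_mul_of_nonneg_left hz (norm_nonneg _)).trans_lt hn

omit [CompleteSpace P] in
/-- The kernel vectors at the points near the origin are total. -/
theorem IsKernelSpace.eq_zero_of_eventually (hk : IsKernelSpace θ Ω kv) (hopen : IsOpen Ω)
    (hconn : IsPreconnected Ω) (h0 : (0 : ℂ) ∈ Ω)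
    (hΩ : Ω ⊆ Metric.ball 0 1) (hθ : DifferentiableOn ℂ θ Ω) {y : P}
    (hy : ∀ᶠ z in 𝓝[≠] (0 : ℂ), ∀ (h : z ∈ Ω) (f : Y), form y (kv ⟨z, h⟩ f) = 0) : y = 0 := by
  have h1 : ∀ (w : Ω) (f : Y), form y (kv w f) = 0 := by
    intro w f
    have h2 := ((hk.differentiableOn hopen hΩ hθ f y).analyticOnNhd hopen)
    have h3 := h2.eqOn_zero_of_preconnected_of_frequently_eq_zero hconn h0 (by
      refine Filter.Eventually.frequently ?_
      filter_upwards [hy, nhdsWithin_le_nhds (hopen.mem_nhds h0)] with z hz hzΩ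
      rw [extendKv_of_mem f hzΩ]
      exact hz hzΩ f)
    have h4 : form y (extendKv kv f w) = 0 := h3 w.2
    rwa [extendKv_of_mem f w.2] at h4
  refine eq_zero_of_form fun x => ?_
  refine hk.dense.induction_on (p := fun x => form y x = 0) x
    (isClosed_eq (continuous_form.comp (continuous_const.prodMk continuous_id)) continuous_const)
    fun a => ?_
  induction a using Finsupp.induction_linear with
  | zero => simp
  | add a b ha hb => rw [map_add, form_add_right, ha, hb, add_zero]
  | single w f => rw [Finsupp.lsum_single]; exact h1 w f

/-! ### The isometry defined by the Schur kernel -/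

section Lurking

variable {ι : Type*}

/-- Pointwise multiplication of a finitely supported function by `conj c`. -/
noncomputable def weight (Y : Type v) [NormedAddCommGroup Y] [InnerProductSpace ℂ Y] (c : ι → ℂ) :
    (ι →₀ Y) →ₗ[ℂ] (ι →₀ Y) :=
  Finsupp.lsum ℂ fun i => conj (c i) • Finsupp.lsingle i

omit [CompleteSpace Y] [PontryaginSpace Y] in
theorem weight_single (c : ι → ℂ) (i : ι) (f : Y) :
    weight Y c (Finsupp.single i f) = conj (c i) • Finsupp.single i f := by
  simp [weight]

/-- The sum of the values of a finitely supported function. -/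
noncomputable def total (Y : Type v) [NormedAddCommGroup Y] [InnerProductSpace ℂ Y] :
    (ι →₀ Y) →ₗ[ℂ] Y :=
  Finsupp.lsum ℂ fun _ => LinearMap.id

omit [CompleteSpace Y] [PontryaginSpace Y] in
theorem total_single (i : ι) (f : Y) : total Y (Finsupp.single i f) = f := by
  simp [total]

/-- The sum of the vectors `θ(cᵢ)* fᵢ`. -/
noncomputable def adjSum (θ : ℂ → (U →L[ℂ] Y)) (c : ι → ℂ) : (ι →₀ Y) →ₗ[ℂ] U :=
  Finsupp.lsum ℂ fun i => (adj (θ (c i))).toLinearMap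

theorem adjSum_single (c : ι → ℂ) (i : ι) (f : Y) :
    adjSum θ c (Finsupp.single i f) = adj (θ (c i)) f := by
  simp [adjSum]

omit [CompleteSpace P] in
/-- The identity `K(w, z) + θ(z) θ(w)* = z w̄ K(w, z) + 1` as an equality of forms. -/
theorem IsKernelSpace.form_identity (hk : IsKernelSpace θ Ω kv) (hΩ : Ω ⊆ Metric.ball 0 1)
    (p : ι → Ω) (a b : ι →₀ Y) :
    form (Finsupp.lsum ℂ (fun i => kv (p i)) a) (Finsupp.lsum ℂ (fun i => kv (p i)) b) +
        form (adjSum θ (fun i => (p i : ℂ)) a) (adjSum θ (fun i => (p i : ℂ)) b) =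
      form (Finsupp.lsum ℂ (fun i => kv (p i)) (weight Y (fun i => (p i : ℂ)) a))
          (Finsupp.lsum ℂ (fun i => kv (p i)) (weight Y (fun i => (p i : ℂ)) b)) +
        form (total Y a) (total Y b) := by
  induction a using Finsupp.induction_linear with
  | zero => simp
  | add a a' ha ha' =>
    simp only [map_add, form_add_left]
    linear_combination ha + ha'
  | single i f =>
    induction b using Finsupp.induction_linear with
    | zero => simp
    | add b b' hb hb' =>
      simp only [map_add, form_add_right]
      linear_combination hb + hb'
    | single j g =>
      simp only [weight_single, map_smul, form_smul_left, form_smul_right, Finsupp.lsum_single,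
        adjSum_single, total_single, hk.form_kv, form_schurKernel, Complex.conj_conj]
      have := one_sub_mul_conj_ne_zero hΩ (p i).2 (p j).2
      field_simp
      ring

omit [CompleteSpace P] in
theorem IsKernelSpace.energy_identity (hk : IsKernelSpace θ Ω kv) (hΩ : Ω ⊆ Metric.ball 0 1)
    (p : ι → Ω) (a : ι →₀ Y) :
    energy (Finsupp.lsum ℂ (fun i => kv (p i)) a) + energy (adjSum θ (fun i => (p i : ℂ)) a) =
      energy (Finsupp.lsum ℂ (fun i => kv (p i)) (weight Y (fun i => (p i : ℂ)) a)) +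
        energy (total Y a) :=
  congrArg Complex.re (hk.form_identity hΩ p a a)

omit [CompleteSpace Y] [PontryaginSpace Y] in
theorem tendsto_weight_pow {Z : Type*} [NormedAddCommGroup Z] [NormedSpace ℂ Z]
    (R : (ι →₀ Y) →ₗ[ℂ] Z) {c : ι → ℂ} (hc : ∀ i, ‖c i‖ < 1) (a : ι →₀ Y) :
    Filter.Tendsto (fun n : ℕ => R ((weight Y c ^ n) a)) Filter.atTop (𝓝 0) := by
  induction a using Finsupp.induction_linear with
  | zero => simp
  | add a b ha hb => simpa only [map_add, add_zero] using ha.add hb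
  | single i f =>
    have h1 : ∀ n : ℕ, (weight Y c ^ n) (Finsupp.single i f) =
        conj (c i) ^ n • Finsupp.single i f := by
      intro n
      induction n with
      | zero => simp
      | succ n ih =>
        rw [pow_succ', Module.End.mul_apply, ih, map_smul, weight_single, smul_smul, pow_succ]
    simp only [h1, map_smul]
    have h2 := tendsto_pow_atTop_nhds_zero_of_norm_lt_one
      (show ‖conj (c i)‖ < 1 by rw [RCLike.norm_conj]; exact hc i)
    simpa using h2.smul_const (R (Finsupp.single i f))

end Lurking

end Kernel

/-! ### Passive realizations of functions of the generalized Schur class -/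

section Kernel

variable {U : Type u} [NormedAddCommGroup U] [InnerProductSpace ℂ U] [CompleteSpace U]
  [PontryaginSpace U]
variable {Y : Type v} [NormedAddCommGroup Y] [InnerProductSpace ℂ Y] [CompleteSpace Y]
  [PontryaginSpace Y]
variable {θ : ℂ → (U →L[ℂ] Y)} {Ω : Set ℂ} {κ : ℕ}

theorem dense_of_forall_form {L : Type*} [AddCommGroup L] [Module ℂ L] {P : Type w}
    [NormedAddCommGroup P] [InnerProductSpace ℂ P] [CompleteSpace P] [PontryaginSpace P]
    {j : L →ₗ[ℂ] P} (h : ∀ x, (∀ a, form x (j a) = 0) → x = 0) : DenseRange j := by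
  have := (topologicalClosure_eq_top_iff (LinearMap.range j)).mpr fun x hx =>
    h x fun a => hx _ ⟨a, rfl⟩
  rw [← Submodule.dense_iff_topologicalClosure_eq_top] at this
  exact this

open LinSystem in
/-- A passive realization of a function whose Schur kernel has `κ` negative squares has a state space
of negative index at least `κ`. The map `kv w f ↦ (1 - w̄ A*)⁻¹ C* f` on the kernel vectors at points
`w` near the origin is a contraction: passivity of the adjoint system shows that its defect `N`
satisfies `N a ≥ N (M a)` for the multiplication `M` by `w̄`, and `Mⁿ a → 0`. -/
theorem le_negIndex_of_isRealization [TopologicalSpace.SeparableSpace Y]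
    (hUY : negIndex U = negIndex Y) (hθ : IsGeneralizedSchur κ θ) {S : LinSystem.{w} U Y}
    (hS : S.IsPassive) (hr : S.IsRealization θ) : κ ≤ negIndex S.X := by
  obtain ⟨Ω, hopen, hconn, h0, hΩ, hdiff, hneg⟩ := hθ
  obtain ⟨P, _, _, _, _, kv, hk, hP⟩ := hneg.exists_kernelSpace.{v}
  let ι := {z : Ω // S.transfer z = θ z ∧ IsUnit (1 - (z : ℂ) • S.A)}
  let p : ι → Ω := Subtype.val
  let c : ι → ℂ := fun i => p i
  let J₀ : (ι →₀ Y) →ₗ[ℂ] P := Finsupp.lsum ℂ fun i => kv (p i)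
  have hJ : DenseRange J₀ := dense_of_forall_form fun y hy => by
    refine hk.eq_zero_of_eventually hopen hconn h0 hΩ hdiff ?_
    filter_upwards [nhdsWithin_le_nhds hr,
      nhdsWithin_le_nhds (eventually_norm_smul_lt S.A)] with z h1 h2 hz f
    have := hy (Finsupp.single ⟨⟨z, hz⟩, h1, isUnit_one_sub h2⟩ f)
    simpa [J₀] using this
  let T : (ι →₀ Y) →ₗ[ℂ] S.X := Finsupp.lsum ℂ fun i =>
    (adj (S.C ∘L Ring.inverse (1 - c i • S.A))).toLinearMap
  let M := weight Y c
  have hT₁ : ∀ a, adj S.A (T (M a)) + adj S.C (total Y a) = T a := by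
    intro a
    induction a using Finsupp.induction_linear with
    | zero => simp
    | add a b ha hb => simp only [map_add, ← ha, ← hb]; abel
    | single i f =>
      have h1 : Ring.inverse (1 - c i • S.A) - c i • (Ring.inverse (1 - c i • S.A) * S.A) = 1 := by
        have := Ring.inverse_mul_cancel _ i.2.2
        rwa [mul_sub, mul_one, mul_smul_comm] at this
      have h2 : S.C ∘L Ring.inverse (1 - c i • S.A) =
          c i • ((S.C ∘L Ring.inverse (1 - c i • S.A)) ∘L S.A) + S.C := by
        ext x
        have h3 := congrArg (fun R : S.X →L[ℂ] S.X => S.C (R x)) (sub_eq_iff_eq_add.mp h1)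
        simp only [add_apply, map_add, smul_apply,
          map_smul] at h3
        exact h3.trans (add_comm _ _)
      have h3 := congrArg (fun R => (adj R) f) h2
      simp only [adj_add, adj_smul] at h3
      rw [adj_comp (S.C ∘L Ring.inverse (1 - c i • S.A)) S.A] at h3
      simp only [M, T, weight_single, map_smul, Finsupp.lsum_single, total_single]
      exact h3.symm
  have hT₂ : ∀ a, adj S.B (T (M a)) + adj S.D (total Y a) = adjSum θ c a := by
    intro a
    induction a using Finsupp.induction_linear with
    | zero => simp
    | add a b ha hb => simp only [map_add, ← ha, ← hb]; abel
    | single i f =>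
      have h2 : θ (c i) = c i • ((S.C ∘L Ring.inverse (1 - c i • S.A)) ∘L S.B) + S.D := by
        rw [← i.2.1, transfer, add_comm]; rfl
      have h3 := congrArg (fun R => (adj R) f) h2
      simp only [adj_add, adj_smul] at h3
      rw [adj_comp (S.C ∘L Ring.inverse (1 - c i • S.A)) S.B] at h3
      simp only [M, T, weight_single, map_smul, Finsupp.lsum_single, total_single, adjSum_single]
      exact h3.symm
  have hstep : ∀ a, energy (J₀ (M a)) - energy (T (M a)) ≤ energy (J₀ a) - energy (T a) := by
    intro a
    have h1 := (dual_isPassive hUY hS).energy_le (T (M a)) (total Y a)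
    have h2 := hk.energy_identity hΩ p a
    change energy (adj S.A (T (M a)) + adj S.C (total Y a)) +
      energy (adj S.B (T (M a)) + adj S.D (total Y a)) ≤
        energy (T (M a)) + energy (total Y a) at h1
    rw [hT₁, hT₂] at h1
    change energy (J₀ a) + energy (adjSum θ c a) = energy (J₀ (M a)) + energy (total Y a) at h2
    linarith
  have hiter : ∀ a (n : ℕ), energy (J₀ ((M ^ n) a)) - energy (T ((M ^ n) a)) ≤
      energy (J₀ a) - energy (T a) := by
    intro a n
    induction n with
    | zero => simp
    | succ n ih => rw [pow_succ', Module.End.mul_apply]; exact (hstep _).trans ih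
  have hc : ∀ i, ‖c i‖ < 1 := fun i => by simpa using hΩ (p i).2
  have hcontr : ∀ a, energy (T a) ≤ energy (J₀ a) := by
    intro a
    have h1 := (continuous_energy.tendsto (0 : P)).comp (tendsto_weight_pow J₀ hc a)
    have h2 := (continuous_energy.tendsto (0 : S.X)).comp (tendsto_weight_pow T hc a)
    have h3 := le_of_tendsto (h1.sub h2) (Filter.Eventually.of_forall (hiter a))
    simpa using h3
  have h1 := HasNeg.of_denseRange hJ (hasNeg_iff.mpr hP.ge)
  exact hasNeg_iff.mp (h1.map T hcontr)

open LinSystem in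
/-- Every function of the generalized Schur class has a passive realization whose state space has the
least possible negative index. The isometry `(w̄ kv w f, f) ↦ (kv w f, θ(w)* f)` is densely defined
because the kernel vectors near the origin are total; its extension is the adjoint of the system
operator. -/
theorem IsGeneralizedSchur.exists_isAdmissible [TopologicalSpace.SeparableSpace Y]
    (hUY : negIndex U = negIndex Y) (hθ : IsGeneralizedSchur κ θ) :
    ∃ S : LinSystem.{w} U Y, S.IsAdmissible κ θ := by
  obtain ⟨Ω, hopen, hconn, h0, hΩ, hdiff, hneg⟩ := hθ
  obtain ⟨P, _, _, _, _, kv, hk, hP⟩ := hneg.exists_kernelSpace.{w}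
  let J₀ : (Ω →₀ Y) →ₗ[ℂ] P := Finsupp.lsum ℂ kv
  let c : Ω → ℂ := Subtype.val
  let ι : (Ω →₀ Y) →ₗ[ℂ] WithLp 2 (P × Y) :=
    (WithLp.linearEquiv 2 ℂ (P × Y)).symm.toLinearMap ∘ₗ (J₀ ∘ₗ weight Y c).prod (total Y)
  let V₀ : (Ω →₀ Y) →ₗ[ℂ] WithLp 2 (P × U) :=
    (WithLp.linearEquiv 2 ℂ (P × U)).symm.toLinearMap ∘ₗ J₀.prod (adjSum θ c)
  have hι₀ : ∀ w f, ι (Finsupp.single w f) = WithLp.toLp 2 (conj (w : ℂ) • kv w f, f) :=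
    fun w f => by
      change WithLp.toLp 2 (J₀ (weight Y c _), total Y _) = _
      simp [J₀, weight_single, total_single, c]
  have hV₀ : ∀ w f, V₀ (Finsupp.single w f) = WithLp.toLp 2 (kv w f, adj (θ w) f) :=
    fun w f => by
      change WithLp.toLp 2 (J₀ _, adjSum θ c _) = _
      simp [J₀, adjSum_single, c]
  have hι : DenseRange ι := dense_of_forall_form fun q hq => by
    have h1 : ∀ (w : Ω) f, form q.fst (conj (w : ℂ) • kv w f) + form q.snd f = 0 := fun w f => by
      have := hq (Finsupp.single w f)
      rwa [hι₀, form_prod] at this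
    have h2 : q.snd = 0 := eq_zero_of_form fun f => by
      have := h1 ⟨0, h0⟩ f
      simpa using this
    have h3 : q.fst = 0 := by
      refine hk.eq_zero_of_eventually hopen hconn h0 hΩ hdiff ?_
      filter_upwards [self_mem_nhdsWithin] with z hz h f
      have := h1 ⟨z, h⟩ f
      rw [h2, form_zero_left, add_zero, form_smul_right, Complex.conj_conj] at this
      exact (mul_eq_zero.mp this).resolve_left hz
    calc q = WithLp.toLp 2 (q.fst, q.snd) := rfl
      _ = 0 := by rw [h2, h3]; rfl
  have hcontr : ∀ a, energy (V₀ a) ≤ energy (ι a) := fun a => by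
    rw [energy_prod, energy_prod]
    exact (hk.energy_identity hΩ id a).le
  obtain ⟨V, hV⟩ := exists_extension (negIndex_prod (X := P) (Y := Y))
    (by rw [negIndex_prod, hUY]) hι hcontr
  let A : P →L[ℂ] P := WithLp.fstL 2 ℂ P U ∘L V ∘L prodInl P Y
  let B : Y →L[ℂ] P := WithLp.fstL 2 ℂ P U ∘L V ∘L prodInr P Y
  have hstate : ∀ (x : P) (f : Y), A x + B f = (V (WithLp.toLp 2 (x, f))).fst := fun x f => by
    rw [toLp_eq_add, map_add]; rfl
  have hA : ∀ (w : Ω) f, A (conj (w : ℂ) • kv w f) + B f = kv w f := fun w f => by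
    rw [hstate, ← hι₀, hV, hV₀]; rfl
  -- the kernel vectors near the origin are given by a Neumann series
  have hinv : ∀ w : Ω, ‖conj (w : ℂ) • A‖ < 1 → ∀ f,
      kv w f = Ring.inverse (1 - conj (w : ℂ) • A) (B f) := by
    intro w hw f
    have h1 : (1 - conj (w : ℂ) • A) (kv w f) = B f := by
      have := hA w f
      rw [map_smul] at this
      exact sub_eq_of_eq_add' this.symm
    have h2 := Ring.inverse_mul_cancel (1 - conj (w : ℂ) • A)
      (Units.oneSub (conj (w : ℂ) • A) hw).isUnit
    have h3 := congrArg (fun R : P →L[ℂ] P => R (kv w f)) h2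
    rw [← h1]
    exact h3.symm
  have hnear : ∀ᶠ z in 𝓝 (0 : ℂ), ‖conj z • A‖ < 1 := by
    have h1 : Filter.Tendsto (fun z : ℂ => ‖conj z • A‖) (𝓝 0) (𝓝 0) := by
      have h : Continuous fun z : ℂ => ‖conj z • A‖ :=
        (Complex.continuous_conj.smul continuous_const).norm
      simpa using h.tendsto 0
    exact h1.eventually_lt_const one_pos
  let j : (ℕ →₀ Y) →ₗ[ℂ] P := Finsupp.lsum ℂ fun n =>
    (((A ^ n) ∘L B : Y →L[ℂ] P) : Y →ₗ[ℂ] P)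
  have hjs : ∀ n f, j (Finsupp.single n f) = (A ^ n) (B f) := fun n f => by
    change Finsupp.lsum ℂ _ _ = _
    rw [Finsupp.lsum_single]; rfl
  have hj : DenseRange j := dense_of_forall_form fun y hy => by
    refine hk.eq_zero_of_eventually hopen hconn h0 hΩ hdiff ?_
    filter_upwards [nhdsWithin_le_nhds hnear] with z hz h f
    rw [hinv ⟨z, h⟩ hz f]
    have h1 : HasSum (fun n : ℕ => (conj z • A) ^ n) (Ring.inverse (1 - conj z • A)) := by
      rw [NormedRing.inverse_one_sub _ hz]
      exact (summable_geometric_of_norm_lt_one hz).hasSum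
    let F : (P →L[ℂ] P) →L[ℂ] ℂ :=
      (innerSL ℂ (J y)) ∘L (ContinuousLinearMap.apply ℂ P (B f))
    have h2 : ∀ n : ℕ, F ((conj z • A) ^ n) = 0 := fun n => by
      have h3 := form_comm_zero (hy (Finsupp.single n f))
      rw [hjs] at h3
      rw [smul_pow, map_smul]
      have h4 : F (A ^ n) = form ((A ^ n) (B f)) y := by
        change inner ℂ (J y) ((A ^ n) (B f)) = _
        rw [J_symm]; rfl
      rw [h4, h3, smul_zero]
    have h5 := F.hasSum h1
    simp only [h2] at h5
    have h6 : F (Ring.inverse (1 - conj z • A)) = 0 := h5.unique hasSum_zero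
    refine form_comm_zero ?_
    rw [← h6, form, ← J_symm]; rfl
  have hsep : TopologicalSpace.SeparableSpace P := separableSpace_of_denseRange hj fun n => by
    simp only [hjs]
    exact ((A ^ n) ∘L B).continuous
  let S : LinSystem.{w} Y U := ofOperator V
  let C : P →L[ℂ] U := S.C
  have hout : ∀ (w : Ω) f, C (conj (w : ℂ) • kv w f) + S.D f = adj (θ w) f := fun w f => by
    refine (ofOperator_output V _ f).trans ?_
    rw [← hι₀, hV, hV₀]; rfl
  refine ⟨S.dual, dual_isPassive hUY.symm (ofOperator_isPassive
    (energy_le_of_dense hι fun a => ?_)), ?_, hP⟩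
  · rw [hV]; exact hcontr a
  · filter_upwards [hnear, hopen.mem_nhds h0] with z hz hzΩ
    have h1 : adj (θ z) = S.transfer (conj z) := by
      ext f
      rw [← hout ⟨z, hzΩ⟩ f, map_smul, hinv ⟨z, hzΩ⟩ hz f, add_comm]
      rfl
    have h2 : IsUnit (1 - conj z • S.A) := (Units.oneSub (conj z • A) hz).isUnit
    have h3 := adj_inverse h2
    rw [adj_sub, adj_one, adj_smul, Complex.conj_conj] at h3
    rw [← adj_adj (θ z), h1, transfer, transfer, adj_add, adj_smul, Complex.conj_conj, adj_comp,
      adj_comp, h3]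
    rfl

end Kernel
namespace LinSystem

/-! ### Admissible controllable and observable parts -/

section Compression

variable {U : Type u} [NormedAddCommGroup U] [InnerProductSpace ℂ U] [CompleteSpace U]
  [TopologicalSpace.SeparableSpace U] [PontryaginSpace U]
variable {Y : Type v} [NormedAddCommGroup Y] [InnerProductSpace ℂ Y] [CompleteSpace Y]
  [TopologicalSpace.SeparableSpace Y] [PontryaginSpace Y]
variable {θ : ℂ → (U →L[ℂ] Y)} {κ : ℕ}

/-- The controllable part of a `κ`-admissible realization is `κ`-admissible, with the same energies;
it is observable if the original realization is. -/
theorem IsAdmissible.exists_controllable (hUY : negIndex U = negIndex Y)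
    (hθ : IsGeneralizedSchur κ θ) {S : LinSystem.{w} U Y} (hS : S.IsAdmissible κ θ) :
    ∃ T : LinSystem.{w} U Y, T.IsAdmissible κ θ ∧ T.IsControllable ∧
      (S.IsObservable → T.IsObservable) ∧
      ∀ ξ, energy (T.reachMap ξ) = energy (S.reachMap ξ) := by
  obtain ⟨hp, hr, hκ⟩ := hS
  obtain ⟨T, hT, hc, hD, hm, hle, hE⟩ := LinSystem.exists_controllable hp hUY
  have hr' : T.IsRealization θ := hr.of_markov hD hm
  have hκ' : negIndex T.X = κ :=
    le_antisymm (hle.trans hκ.le) (le_negIndex_of_isRealization hUY hθ hT hr')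
  refine ⟨T, ⟨hT, hr', hκ'⟩, hc, fun ho => ?_, hE⟩
  -- `T` embeds isometrically into `S`, compatibly with the output operators
  obtain ⟨V, hV, hVA, -, hVC⟩ := exists_intertwiner hc (hκ'.trans hκ.symm) hm fun ξ => (hE ξ).ge
  have hinj := injective_of_energy (energy_eq_of_dense hc hV fun ξ => (hE ξ).symm)
  rw [isObservable_iff] at ho ⊢
  intro x hx
  have hn : ∀ n, V ((T.A ^ n) x) = (S.A ^ n) (V x) := by
    intro n
    induction n with
    | zero => rfl
    | succ n ih =>
      rw [pow_succ', pow_succ']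
      change V (T.A ((T.A ^ n) x)) = S.A ((S.A ^ n) (V x))
      rw [hVA, ih]
  refine hinj ((ho (V x) fun n => ?_).trans (map_zero V).symm)
  rw [← hn, ← hVC, hx]

omit [TopologicalSpace.SeparableSpace U] in
/-- The observable part of a `κ`-admissible realization is `κ`-admissible, and its states have no
larger energies: they are the images of the original states under the adjoint of an isometry. -/
theorem IsAdmissible.exists_observable (hUY : negIndex U = negIndex Y)
    (hθ : IsGeneralizedSchur κ θ) {S : LinSystem.{w} U Y} (hS : S.IsAdmissible κ θ) :
    ∃ T : LinSystem.{w} U Y, T.IsAdmissible κ θ ∧ T.IsObservable ∧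
      ∀ ξ, energy (T.reachMap ξ) ≤ energy (S.reachMap ξ) := by
  obtain ⟨hp, hr, hκ⟩ := hS
  obtain ⟨R, hR, hc, hD, hm, hle, hE⟩ :=
    LinSystem.exists_controllable (dual_isPassive hUY hp) hUY.symm
  have hp' : R.dual.IsPassive := dual_isPassive hUY.symm hR
  have hr' : R.dual.IsRealization θ := by
    refine hr.of_markov ?_ fun n => ?_
    · change adj R.D = S.D
      rw [hD]; exact adj_adj _
    · rw [dual_markov, hm, dual_markov, adj_adj]
  have hκ' : negIndex R.X = κ :=
    le_antisymm (hle.trans hκ.le) (le_negIndex_of_isRealization hUY hθ hp' hr')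
  obtain ⟨V, hV, hVA, hVB, hVC⟩ :=
    exists_intertwiner hc (hκ'.trans hκ.symm) hm fun ξ => (hE ξ).ge
  change R.X →L[ℂ] S.X at V
  have hVE : ∀ x, energy (V x) = energy x := energy_eq_of_dense hc hV fun ξ => (hE ξ).symm
  have hB : ∀ a, adj V (S.B a) = adj R.C a := fun a => by
    have h : R.C = adj S.B ∘L V := ContinuousLinearMap.ext hVC
    rw [h, adj_comp, adj_adj]; rfl
  have hA : ∀ x, adj V (S.A x) = adj R.A (adj V x) := fun x => by
    have h : V ∘L R.A = adj S.A ∘L V := ContinuousLinearMap.ext hVA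
    have h' := congrArg (fun M => adj M x) h
    simp only [adj_comp, adj_adj] at h'
    exact h'.symm
  have hreach : ∀ ξ, R.dual.reachMap ξ = adj V (S.reachMap ξ) := by
    have hn : ∀ (n : ℕ) x, adj V ((S.A ^ n) x) = (adj R.A ^ n) (adj V x) := by
      intro n x
      induction n with
      | zero => rfl
      | succ n ih =>
        rw [pow_succ', pow_succ']
        change adj V (S.A ((S.A ^ n) x)) = adj R.A ((adj R.A ^ n) (adj V x))
        rw [hA, ih]
    intro ξ
    induction ξ using Finsupp.induction_linear with
    | zero => simp only [map_zero]; rfl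
    | add f g hf hg => simp only [map_add, hf, hg]; rfl
    | single n a => rw [reachMap_single, reachMap_single, hn, hB]; rfl
  refine ⟨R.dual, ⟨hp', hr', hκ'⟩, ?_, fun ξ => ?_⟩
  · rw [isObservable_iff_dual, dual_dual]; exact hc
  · rw [hreach]
    exact energy_adj_le (hκ'.trans hκ.symm) (fun x => (hVE x).le) _

end Compression

end LinSystem
end PontryaginSpace

theorem mainTheorem5
    {U : Type u} [NormedAddCommGroup U] [InnerProductSpace ℂ U] [CompleteSpace U]
    [TopologicalSpace.SeparableSpace U] [PontryaginSpace U]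
    {Y : Type v} [NormedAddCommGroup Y] [InnerProductSpace ℂ Y] [CompleteSpace Y]
    [TopologicalSpace.SeparableSpace Y] [PontryaginSpace Y]
    (hUY : PontryaginSpace.negIndex U = PontryaginSpace.negIndex Y)
    (κ : ℕ) (θ : ℂ → (U →L[ℂ] Y)) (hθ : PontryaginSpace.IsGeneralizedSchur κ θ) :
    List.TFAE [
      ∀ S T : PontryaginSpace.LinSystem.{w} U Y,
        S.IsAdmissible κ θ → S.IsMinimal → T.IsAdmissible κ θ → T.IsMinimal →
          S.UnitarilySimilar T,
      ∃ S : PontryaginSpace.LinSystem.{w} U Y,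
        S.IsPassive ∧ S.IsRealization θ ∧ S.IsMinimal ∧
          S.IsOptimal κ θ ∧ S.IsStarOptimal κ θ,
      ∀ S : PontryaginSpace.LinSystem.{w} U Y,
        S.IsAdmissible κ θ → S.IsMinimal → S.IsOptimal κ θ ∧ S.IsStarOptimal κ θ] := by
  open PontryaginSpace LinSystem in
  tfae_have 1 → 3 := by
    intro h S hS hmin
    refine ⟨⟨hS, fun T hT => forall_energy_reach_le_iff.mpr fun ξ => ?_⟩,
      ⟨hS, hmin.2, fun T hT ho => forall_energy_reach_le_iff.mpr fun ξ => ?_⟩⟩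
    · obtain ⟨T₁, hT₁, ho₁, hE₁⟩ := hT.exists_observable hUY hθ
      obtain ⟨T₂, hT₂, hc₂, ho₂, hE₂⟩ := hT₁.exists_controllable hUY hθ
      rw [← (h S T₂ hS hmin hT₂ ⟨hc₂, ho₂ ho₁⟩).energy_reachMap, hE₂]
      exact hE₁ ξ
    · obtain ⟨T₁, hT₁, hc₁, ho₁, hE₁⟩ := hT.exists_controllable hUY hθ
      rw [← (h S T₁ hS hmin hT₁ ⟨hc₁, ho₁ ho⟩).energy_reachMap, hE₁]
  open PontryaginSpace LinSystem in
  tfae_have 3 → 2 := by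
    intro h
    obtain ⟨S, hS⟩ := hθ.exists_isAdmissible.{w} hUY
    obtain ⟨S₁, hS₁, ho₁, -⟩ := hS.exists_observable hUY hθ
    obtain ⟨S₂, hS₂, hc₂, ho₂, -⟩ := hS₁.exists_controllable hUY hθ
    exact ⟨S₂, hS₂.1, hS₂.2.1, ⟨hc₂, ho₂ ho₁⟩, h S₂ hS₂ ⟨hc₂, ho₂ ho₁⟩⟩
  open PontryaginSpace LinSystem in
  tfae_have 2 → 1 := by
    rintro ⟨R, -, -, -, hopt, hstar⟩ S T hS hSmin hT hTmin
    have key : ∀ S' : LinSystem.{w} U Y, S'.IsAdmissible κ θ → S'.IsMinimal →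
        ∀ ξ, energy (S'.reachMap ξ) = energy (R.reachMap ξ) := fun S' h hmin ξ =>
      le_antisymm (forall_energy_reach_le_iff.mp (hstar.2.2 S' h hmin.2) ξ)
        (forall_energy_reach_le_iff.mp (hopt.2 S' h) ξ)
    obtain ⟨hD, hm⟩ := hS.2.1.markov_eq hT.2.1
    exact unitarilySimilar_of_energy_eq hSmin.1 hTmin.1 (hS.2.2.trans hT.2.2.symm) hD hm
      fun ξ => (key T hT hTmin ξ).trans (key S hS hSmin ξ).symm
  tfae_finish
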